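/- Let $K$ be a field, $G$ a group, $H\le G$ a subgroup and $n>0$ an integer. **Partial actions.** A partial action $\alpha$ of $G$ on a unital associative $K$-algebra $\mathcal A$ consists of two-sided ideals $\mathcal D_g$ ($g\in G$) of $\mathcal A$ and $K$-algebra isomorphisms $\alpha_g:\mathcal D_{g^{-1}}\to\mathcal D_g$ such that $\mathcal D_1=\mathcal A$, $\alpha_1=\mathrm{id}$, $\alpha_h^{-1}(\mathcal D_h\cap\mathcal D_{g^{-1}})\subseteq\mathcal D_{(gh)^{-1}}$, and $\alpha_g(\alpha_h(x))=\alpha_{gh}(x)$ for all $x\in\alpha_h^{-1}(\mathcal D_h\cap\mathcal D_{g^{-1}})$. Partial actions $\alpha$ on $\mathcal A$ and $\alpha'$ on $\mathcal A'$ are equivalent if there is a $K$-algebra isomorphism $\varphi:\mathcal A\to\mathcal A'$ with $\varphi(\mathcal D_g)=\mathcal D'_g$ and $\alpha'_g\circ\varphi=\varphi\circ\alpha_g$ on $\mathcal D_{g^{-1}}$ for all $g\in G$. If every $\mathcal D_g$ has a unity $1_g$ (which is always the case for $\mathcal A=K^n$), let $\mathcal A\rtimes_\alpha G$ be the algebra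 of finite formal sums $\sum_g a_g\delta_g$, $a_g\in\mathcal D_g$, with $(a\delta_g)(b\delta_h)=\alpha_g(\alpha_{g^{-1}}(a)b)\delta_{gh}$. For a partial action $\alpha$ on $K^n$ set $A_i(\alpha)=\{g\in G:(1_g)_i\ne0\}$, $1\le i\le n$. **Partial representations.** A partial representation of $G$ into a unital $K$-algebra $\mathcal B$ is a map $\pi:G\to\mathcal B$ with $\pi(1)=1$, $\pi(g)\pi(h)\pi(h^{-1})=\pi(gh)\pi(h^{-1})$ and $\pi(g^{-1})\pi(g)\pi(h)=\pi(g^{-1})\pi(gh)$ for all $g,h\in G$. Two partial representations $\pi:G\to\mathcal B$, $\pi':G\to\mathcal B'$ are equivalent if $\pi=\varphi\circ\pi'$ for some $K$-algebra isomorphism $\varphi:\mathcal B'\to\mathcal B$. **The two constructions.** For a partial action $\alpha$ on an algebra $\mathcal A$ whose ideals $\mathcal D_g$ have unities $1_g$, let $\pi_\alpha:G\to\mathcal A\rtimes_\alpha G$ be the partial representation $g\mapsto 1_g\delta_g$. For a partial representation $\pi:G\to\mathcal B$ put $\varepsilon_g=\pi(g)\pi(g^{-1})$, let $\mathcal A\subseteq\mathcal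 B$ be the subalgebra generated by all $\varepsilon_g$, and let $\alpha^\pi$ be the partial action of $G$ on $\mathcal A$ with $\mathcal D_g=\varepsilon_g\mathcal A$ and $\alpha^\pi_g(a)=\pi(g)a\pi(g^{-1})$ for $a\in\mathcal D_{g^{-1}}$. **Elementary partial representations.** For $A\subseteq G$ let $St(A)=\{g\in G:gA=A\}$ and, if $H= St(A)$, let $(A:H)$ be the number of right cosets $Ha$ with $a\in A$. Let $A\ni1$ be a subset of $G$ with $St(A)=H$ and $(A:H)=n$; let $A_1=A,A_2,\dots,A_n$ be the distinct sets among the $gA$ with $g^{-1}\in A$, and choose $g_i\in G$ with $g_iA=A_i$. The corresponding elementary partial representation $\pi:G\to M_n(KH)$ is $$\pi(g)=\sum_{i:\,g^{-1}\in A_i}e_{j,i}(g_j^{-1}gg_i),\qquad\text{where } j=j(i,g)\text{ is determined by } gA_i=A_j,$$ and $e_{j,i}(h)$ is the matrix whose only non-zero entry is $h\in H$, at position $(j,i)$. **Theorem.** (a) For every elementary partial representation $\pi:G\to M_n(KH)$ the subalgebra generated by all $\varepsilon_g$ is the diagonal subalgebra $\mathrm{diag}(K,\dots,K)$ of $M_n(K)\subseteq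 M_n(KH)$, and under the identification $\mathrm{diag}(K,\dots,K)=K^n$ the partial action $\alpha^\pi$ is a partial action of $G$ on $K^n$ with $St(A_1(\alpha^\pi))=H$ and $(A_1(\alpha^\pi):H)=n$. (b) The maps $\pi\mapsto\alpha^\pi$ and $\alpha\mapsto\pi_\alpha$ induce mutually inverse bijections between the set of equivalence classes of elementary partial representations $\pi:G\to M_n(KH)$ and the set of equivalence classes of partial actions $\alpha$ of $G$ on $K^n$ with $St(A_1(\alpha))=H$ and $(A_1(\alpha):H)=n$. Here the class assigned to an $\alpha$ is the class of the elementary partial representations $G\to M_n(KH)$ that are equivalent to $\pi_\alpha$. -/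

import Mathlib

open scoped Pointwise DirectSum

noncomputable section

namespace PartialActions

/-! ### Partial actions of groups on algebras -/

/-- A partial action of a group `G` on a (unital, associative) `K`-algebra `A`: ideals `D g` of `A`
and algebra isomorphisms `act g : D g⁻¹ → D g`.  The map `act g` is written as a function on `A`;
only its values on `D g⁻¹` have a meaning, and all notions below depend on these values only. -/
structure PartialAction (K G A : Type*) [Field K] [Group G] [Ring A] [Algebra K A] where
  /-- the domains, two-sided ideals of the algebra `A` -/
  D : G → Submodule K A
  mul_mem_left : ∀ (g : G) (a : A) {x : A}, x ∈ D g → a * x ∈ D g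
  mul_mem_right : ∀ (g : G) (a : A) {x : A}, x ∈ D g → x * a ∈ D g
  /-- the partial maps -/
  act : G → A → A
  bijOn : ∀ g : G, Set.BijOn (act g) (D g⁻¹) (D g)
  map_add : ∀ (g : G) {x y : A}, x ∈ D g⁻¹ → y ∈ D g⁻¹ → act g (x + y) = act g x + act g y
  map_smul : ∀ (g : G) (c : K) {x : A}, x ∈ D g⁻¹ → act g (c • x) = c • act g x
  map_mul : ∀ (g : G) {x y : A}, x ∈ D g⁻¹ → y ∈ D g⁻¹ → act g (x * y) = act g x * act g y
  D_one : D 1 = ⊤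
  act_one : ∀ x : A, act 1 x = x
  /-- `D (gh)⁻¹ ⊇ α_h⁻¹ (D h ∩ D g⁻¹)` -/
  mem_of_act_mem : ∀ (g h : G) {x : A}, x ∈ D h⁻¹ → act h x ∈ D g⁻¹ → x ∈ D (g * h)⁻¹
  /-- `α_g (α_h x) = α_{gh} x` on `α_h⁻¹ (D h ∩ D g⁻¹)` -/
  act_act : ∀ (g h : G) {x : A}, x ∈ D h⁻¹ → act h x ∈ D g⁻¹ → act g (act h x) = act (g * h) x

namespace PartialAction

variable {K G A A' A'' : Type*} [Field K] [Group G] [Ring A] [Algebra K A] [Ring A'] [Algebra K A']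
  [Ring A''] [Algebra K A'']

/-- `φ : A → A'` carries the partial action `α` on `A` onto the partial action `α'` on `A'`. -/
def IsEquivalence (φ : A ≃ₐ[K] A') (α : PartialAction K G A) (α' : PartialAction K G A') : Prop :=
  (∀ g : G, φ '' (α.D g : Set A) = (α'.D g : Set A')) ∧
    ∀ g : G, ∀ x ∈ α.D g⁻¹, α'.act g (φ x) = φ (α.act g x)

/-- Equivalence of partial actions of the same group on possibly different algebras. -/
def Equivalent (α : PartialAction K G A) (α' : PartialAction K G A') : Prop :=
  ∃ φ : A ≃ₐ[K] A', IsEquivalence φ α α'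

theorem Equivalent.refl (α : PartialAction K G A) : Equivalent α α :=
  ⟨AlgEquiv.refl, fun g => by simp, fun g x _ => rfl⟩

theorem Equivalent.symm {α : PartialAction K G A} {α' : PartialAction K G A'}
    (h : Equivalent α α') : Equivalent α' α := by
  obtain ⟨φ, h1, h2⟩ := h
  refine ⟨φ.symm, fun g => ?_, fun g x hx => ?_⟩
  · rw [← h1 g, Set.image_image]
    simp
  · have hx' : x ∈ (α'.D g⁻¹ : Set A') := hx
    rw [← h1] at hx'
    obtain ⟨y, hy, rfl⟩ := hx'
    rw [h2 g y hy]
    simp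

theorem Equivalent.trans {α : PartialAction K G A} {α' : PartialAction K G A'}
    {α'' : PartialAction K G A''} (h : Equivalent α α') (h' : Equivalent α' α'') :
    Equivalent α α'' := by
  obtain ⟨φ, h1, h2⟩ := h
  obtain ⟨ψ, h3, h4⟩ := h'
  refine ⟨φ.trans ψ, fun g => ?_, fun g x hx => ?_⟩
  · rw [← h3 g, ← h1 g, Set.image_image]
    rfl
  · have hx' : φ x ∈ (α'.D g⁻¹ : Set A') := by
      rw [← h1]
      exact ⟨x, hx, rfl⟩
    simp only [AlgEquiv.trans_apply]
    rw [h4 g _ hx', h2 g x hx]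

section basic

variable (α : PartialAction K G A)

theorem act_mem {g : G} {x : A} (hx : x ∈ α.D g⁻¹) : α.act g x ∈ α.D g :=
  (α.bijOn g).mapsTo hx

theorem mem_inv_inv {g : G} {x : A} (hx : x ∈ α.D g) : x ∈ α.D g⁻¹⁻¹ := by
  rwa [inv_inv]

theorem act_inv_mem {g : G} {x : A} (hx : x ∈ α.D g) : α.act g⁻¹ x ∈ α.D g⁻¹ :=
  α.act_mem (α.mem_inv_inv hx)

theorem act_inv_act {g : G} {x : A} (hx : x ∈ α.D g⁻¹) : α.act g⁻¹ (α.act g x) = x := by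
  rw [α.act_act _ _ hx (α.mem_inv_inv (α.act_mem hx)), inv_mul_cancel, α.act_one]

theorem act_act_inv {g : G} {x : A} (hx : x ∈ α.D g) : α.act g (α.act g⁻¹ x) = x := by
  rw [α.act_act _ _ (α.mem_inv_inv hx) (α.act_inv_mem hx), mul_inv_cancel, α.act_one]

/-- `α_g (D g⁻¹ ∩ D h) ⊆ D (gh)` -/
theorem act_mem_mul {g h : G} {x : A} (hx : x ∈ α.D g⁻¹) (hx' : x ∈ α.D h) :
    α.act g x ∈ α.D (g * h) := by
  have := α.mem_of_act_mem h⁻¹ g⁻¹ (α.mem_inv_inv (α.act_mem hx))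
    (by rw [α.act_inv_act hx, inv_inv]; exact hx')
  simpa using this

end basic

/-! ### Unities of the domains -/

/-- `e` is a unity element of the ideal `I`. -/
def IsUnity (I : Submodule K A) (e : A) : Prop :=
  e ∈ I ∧ ∀ x ∈ I, e * x = x ∧ x * e = x

theorem IsUnity.eq {I : Submodule K A} {e e' : A} (h : IsUnity I e) (h' : IsUnity I e') :
    e = e' := by
  rw [← (h'.2 e h.1).1, (h.2 e' h'.1).2]

/-- Each domain `D g` is a unital algebra. -/
def HasUnities (α : PartialAction K G A) : Prop :=
  ∀ g : G, ∃ e : A, IsUnity (α.D g) e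

/-- The unity element `1_g` of `D g`. -/
def unity (α : PartialAction K G A) (h : α.HasUnities) (g : G) : A := (h g).choose

section unity

variable (α : PartialAction K G A) (hα : α.HasUnities)

theorem unity_spec (g : G) : IsUnity (α.D g) (α.unity hα g) := (hα g).choose_spec

theorem unity_mem (g : G) : α.unity hα g ∈ α.D g := (α.unity_spec hα g).1

theorem unity_mul {g : G} {x : A} (hx : x ∈ α.D g) : α.unity hα g * x = x :=
  ((α.unity_spec hα g).2 x hx).1

theorem mul_unity {g : G} {x : A} (hx : x ∈ α.D g) : x * α.unity hα g = x :=
  ((α.unity_spec hα g).2 x hx).2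

theorem unity_one : α.unity hα 1 = 1 := by
  have h : (1 : A) ∈ α.D 1 := by rw [α.D_one]; trivial
  simpa using α.unity_mul hα h

theorem unity_inter (g h : G) :
    IsUnity (α.D g ⊓ α.D h) (α.unity hα g * α.unity hα h) := by
  refine ⟨⟨α.mul_mem_right _ _ (α.unity_mem hα g), α.mul_mem_left _ _ (α.unity_mem hα h)⟩, ?_⟩
  rintro x ⟨hx, hx'⟩
  rw [mul_assoc, α.unity_mul hα hx', α.unity_mul hα hx, ← mul_assoc, α.mul_unity hα hx,
    α.mul_unity hα hx']
  exact ⟨rfl, rfl⟩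

theorem act_unity (g h : G) : α.act g (α.unity hα g⁻¹ * α.unity hα h) =
    α.unity hα g * α.unity hα (g * h) := by
  have hu := α.unity_inter hα g⁻¹ h
  refine IsUnity.eq (I := α.D g ⊓ α.D (g * h)) ⟨⟨?_, ?_⟩, ?_⟩ (α.unity_inter hα g (g * h))
  · exact α.act_mem hu.1.1
  · exact α.act_mem_mul hu.1.1 hu.1.2
  · rintro x ⟨hx, hx'⟩
    have h1 : α.act g⁻¹ x ∈ α.D g⁻¹ ⊓ α.D h := by
      refine ⟨α.act_inv_mem hx, ?_⟩
      have := α.act_mem_mul (α.mem_inv_inv hx) hx'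
      simpa using this
    have h2 := hu.2 _ h1
    have h3 := α.act_act_inv hx
    constructor
    · rw [← h3, ← α.map_mul _ hu.1.1 h1.1, h2.1]
    · rw [← h3, ← α.map_mul _ h1.1 hu.1.1, h2.2]

end unity

/-! ### The crossed product -/

/-- The crossed product (skew group ring) of `A` by a partial action `α` with unital domains: finite
formal sums `∑ a_g δ_g` with `a_g ∈ D g`. -/
def CrossedProduct (α : PartialAction K G A) (_ : α.HasUnities) : Type _ :=
  ⨁ g : G, α.D g

namespace CrossedProduct

variable {α : PartialAction K G A} {hα : α.HasUnities}

instance : AddCommGroup (α.CrossedProduct hα) :=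
  inferInstanceAs (AddCommGroup (⨁ g : G, α.D g))

instance : Module K (α.CrossedProduct hα) :=
  inferInstanceAs (Module K (⨁ g : G, α.D g))

open Classical in
/-- The element `a δ_g`, as a linear function of `a ∈ D g`. -/
def delta (α : PartialAction K G A) (hα : α.HasUnities) (g : G) :
    α.D g →ₗ[K] α.CrossedProduct hα :=
  DirectSum.lof K G (fun g => α.D g) g

theorem delta_congr {g g' : G} (h : g = g') (x : α.D g) (x' : α.D g') (hx : (x : A) = x') :
    delta α hα g x = delta α hα g' x' := by
  subst h
  congr 1
  exact Subtype.ext hx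

/-- The coefficient `α_g (α_{g⁻¹} (a) b)` of the product of `a δ_g` and `b δ_h`. -/
def coeffMul (α : PartialAction K G A) (g h : G) : α.D g →ₗ[K] α.D h →ₗ[K] α.D (g * h) :=
  LinearMap.mk₂ K
    (fun a b => ⟨α.act g (α.act g⁻¹ a * b), α.act_mem_mul
      (α.mul_mem_right _ _ (α.act_inv_mem a.2)) (α.mul_mem_left _ _ b.2)⟩)
    (fun a a' b => Subtype.ext <| by
      have h1 := α.act_inv_mem a.2
      have h2 := α.act_inv_mem a'.2
      simp only [Submodule.coe_add]
      rw [α.map_add _ (α.mem_inv_inv a.2) (α.mem_inv_inv a'.2), add_mul,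
        α.map_add _ (α.mul_mem_right _ _ h1) (α.mul_mem_right _ _ h2)])
    (fun c a b => Subtype.ext <| by
      have h1 := α.act_inv_mem a.2
      simp only [Submodule.coe_smul]
      rw [α.map_smul _ _ (α.mem_inv_inv a.2), smul_mul_assoc,
        α.map_smul _ _ (α.mul_mem_right _ _ h1)])
    (fun a b b' => Subtype.ext <| by
      have h1 := α.act_inv_mem a.2
      simp only [Submodule.coe_add]
      rw [mul_add, α.map_add _ (α.mul_mem_right _ _ h1) (α.mul_mem_right _ _ h1)])
    (fun c a b => Subtype.ext <| by
      have h1 := α.act_inv_mem a.2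
      simp only [Submodule.coe_smul]
      rw [mul_smul_comm, α.map_smul _ _ (α.mul_mem_right _ _ h1)])

theorem coeffMul_coe (g h : G) (a : α.D g) (b : α.D h) :
    (coeffMul α g h a b : A) = α.act g (α.act g⁻¹ a * b) := rfl

open Classical in
/-- The linear map on the crossed product with prescribed values on the `a δ_g`. -/
def lift {M : Type*} [AddCommGroup M] [Module K M] (α : PartialAction K G A) (hα : α.HasUnities)
    (f : ∀ g : G, α.D g →ₗ[K] M) : α.CrossedProduct hα →ₗ[K] M :=
  DirectSum.toModule K G M f

theorem lift_delta {M : Type*} [AddCommGroup M] [Module K M] (f : ∀ g : G, α.D g →ₗ[K] M)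
    (g : G) (a : α.D g) : lift α hα f (delta α hα g a) = f g a := by
  classical
  exact DirectSum.toModule_lof (M := fun g => α.D g) K g a

/-- The bilinear extension of `(a δ_g) (b δ_h) = α_g (α_{g⁻¹} (a) b) δ_{gh}`. -/
def mulBilin (α : PartialAction K G A) (hα : α.HasUnities) :
    α.CrossedProduct hα →ₗ[K] α.CrossedProduct hα →ₗ[K] α.CrossedProduct hα :=
  lift α hα fun g => LinearMap.flip <|
    lift α hα fun h => LinearMap.flip <|
      (coeffMul α g h).compr₂ (delta α hα (g * h))

instance : Mul (α.CrossedProduct hα) := ⟨fun x y => mulBilin α hα x y⟩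

instance : One (α.CrossedProduct hα) := ⟨delta α hα 1 ⟨1, by rw [α.D_one]; trivial⟩⟩

theorem mul_def (x y : α.CrossedProduct hα) : x * y = mulBilin α hα x y := rfl

theorem one_def : (1 : α.CrossedProduct hα) = delta α hα 1 ⟨1, by rw [α.D_one]; trivial⟩ := rfl

theorem delta_mul_delta (g h : G) (a : α.D g) (b : α.D h) :
    delta α hα g a * delta α hα h b = delta α hα (g * h) (coeffMul α g h a b) := by
  rw [mul_def, mulBilin, lift_delta, LinearMap.flip_apply, lift_delta]
  rfl

theorem linearMap_ext {M : Type*} [AddCommGroup M] [Module K M] {f f' : α.CrossedProduct hα →ₗ[K] M}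
    (h : ∀ g a, f (delta α hα g a) = f' (delta α hα g a)) : f = f' := by
  classical
  refine DirectSum.linearMap_ext K fun g => LinearMap.ext fun a => ?_
  exact h g a

theorem assoc_aux (hα : α.HasUnities) (g h k : G) (a : α.D g) (b : α.D h) (c : α.D k) :
    (coeffMul α (g * h) k (coeffMul α g h a b) c : A) =
      coeffMul α g (h * k) a (coeffMul α h k b c) := by
  simp only [coeffMul_coe]
  -- the product `α_h (α_{h⁻¹} (x) c)` is `x * t` for a fixed `t`
  have hu : ∀ x : A, x ∈ α.D h → α.act h (α.act h⁻¹ x * c) =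
      x * α.act h (α.unity hα h⁻¹ * c) := by
    intro x hx
    have h1 := α.act_inv_mem hx
    rw [← α.mul_unity hα h1, mul_assoc, α.map_mul _ h1
      (α.mul_mem_right _ _ (α.unity_mem hα _)), α.act_act_inv hx]
  set u : A := α.act g⁻¹ a * b with hu_def
  have hug : u ∈ α.D g⁻¹ := α.mul_mem_right _ _ (α.act_inv_mem a.2)
  have huh : u ∈ α.D h := α.mul_mem_left _ _ b.2
  have h1 : α.act (g * h)⁻¹ (α.act g u) = α.act h⁻¹ u := by
    have := α.act_act h⁻¹ g⁻¹ (α.mem_inv_inv (α.act_mem hug))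
      (by rw [α.act_inv_act hug]; exact α.mem_inv_inv huh)
    rw [mul_inv_rev, ← this, α.act_inv_act hug]
  have h2 : α.act h⁻¹ u * (c : A) ∈ α.D h⁻¹ := α.mul_mem_right _ _ (α.act_inv_mem huh)
  have h3 : α.act h (α.act h⁻¹ u * c) ∈ α.D g⁻¹ := by
    rw [hu u huh]
    exact α.mul_mem_right _ _ hug
  rw [h1, ← α.act_act g h h2 h3, hu u huh, hu _ b.2, hu_def, mul_assoc]

theorem mul_assoc' (x y z : α.CrossedProduct hα) : x * y * z = x * (y * z) := by
  have key : (mulBilin α hα).compr₂ (mulBilin α hα) =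
      LinearMap.lcomp K _ (mulBilin α hα) ∘ₗ LinearMap.llcomp K _ _ _ ∘ₗ mulBilin α hα := by
    refine linearMap_ext fun g a => linearMap_ext fun h b => linearMap_ext fun k c => ?_
    change delta α hα g a * delta α hα h b * delta α hα k c =
      delta α hα g a * (delta α hα h b * delta α hα k c)
    simp only [delta_mul_delta]
    exact delta_congr (mul_assoc g h k) _ _ (assoc_aux hα g h k a b c)
  exact LinearMap.congr_fun (LinearMap.congr_fun (LinearMap.congr_fun key x) y) z

theorem one_mul' (x : α.CrossedProduct hα) : 1 * x = x := by
  have key : mulBilin α hα 1 = LinearMap.id := by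
    refine linearMap_ext fun g a => ?_
    change 1 * delta α hα g a = delta α hα g a
    rw [one_def, delta_mul_delta]
    exact delta_congr (one_mul g) _ _ (by simp [coeffMul_coe, α.act_one])
  exact LinearMap.congr_fun key x

theorem mul_one' (x : α.CrossedProduct hα) : x * 1 = x := by
  have key : (mulBilin α hα).flip 1 = LinearMap.id := by
    refine linearMap_ext fun g a => ?_
    change delta α hα g a * 1 = delta α hα g a
    rw [one_def, delta_mul_delta]
    exact delta_congr (mul_one g) _ _ (by simp [coeffMul_coe, α.act_act_inv a.2])
  exact LinearMap.congr_fun key x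

instance : Ring (α.CrossedProduct hα) :=
  { (inferInstance : AddCommGroup (α.CrossedProduct hα)) with
    mul := (· * ·)
    one := 1
    left_distrib := fun x y z => _root_.map_add (mulBilin α hα x) y z
    right_distrib := fun x y z => LinearMap.map_add₂ (mulBilin α hα) x y z
    zero_mul := fun x => LinearMap.map_zero₂ (mulBilin α hα) x
    mul_zero := fun x => _root_.map_zero (mulBilin α hα x)
    mul_assoc := mul_assoc'
    one_mul := one_mul'
    mul_one := mul_one' }

instance : Algebra K (α.CrossedProduct hα) :=
  Algebra.ofModule (fun c x y => LinearMap.map_smul₂ (mulBilin α hα) c x y)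
    (fun c x y => _root_.map_smul (mulBilin α hα x) c y)

theorem unity_delta_mul (g h : G) (x : α.D g) (y : α.D h) (z : α.D (g * h))
    (hz : α.act g (α.act g⁻¹ x * y) = z) :
    delta α hα g x * delta α hα h y = delta α hα (g * h) z := by
  rw [delta_mul_delta]
  exact delta_congr rfl _ _ hz

end CrossedProduct

end PartialAction

/-! ### Partial representations -/

/-- A partial representation of a group `G` into a unital algebra `B`. -/
structure PartialRep (G B : Type*) [Group G] [Ring B] where
  toFun : G → B
  map_one : toFun 1 = 1
  mul_mul_inv : ∀ g h : G, toFun g * toFun h * toFun h⁻¹ = toFun (g * h) * toFun h⁻¹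
  inv_mul_mul : ∀ g h : G, toFun g⁻¹ * toFun g * toFun h = toFun g⁻¹ * toFun (g * h)

namespace PartialRep

instance {G B : Type*} [Group G] [Ring B] : CoeFun (PartialRep G B) fun _ => G → B :=
  ⟨PartialRep.toFun⟩

section equiv

variable (K : Type*) {G B B' B'' : Type*} [Field K] [Group G] [Ring B] [Algebra K B] [Ring B']
  [Algebra K B'] [Ring B''] [Algebra K B'']

/-- Equivalence of partial representations of `G` into possibly different `K`-algebras. -/
def Equivalent (π : PartialRep G B) (π' : PartialRep G B') : Prop :=
  ∃ φ : B' ≃ₐ[K] B, ∀ g : G, π g = φ (π' g)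

variable {K}

theorem Equivalent.refl (π : PartialRep G B) : Equivalent K π π :=
  ⟨AlgEquiv.refl, fun _ => rfl⟩

theorem Equivalent.symm {π : PartialRep G B} {π' : PartialRep G B'} (h : Equivalent K π π') :
    Equivalent K π' π := by
  obtain ⟨φ, h⟩ := h
  exact ⟨φ.symm, fun g => by rw [h g, AlgEquiv.symm_apply_apply]⟩

theorem Equivalent.trans {π : PartialRep G B} {π' : PartialRep G B'} {π'' : PartialRep G B''}
    (h : Equivalent K π π') (h' : Equivalent K π' π'') : Equivalent K π π'' := by
  obtain ⟨φ, h⟩ := h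
  obtain ⟨ψ, h'⟩ := h'
  exact ⟨ψ.trans φ, fun g => by rw [h g, h' g]; rfl⟩

end equiv

/-! ### The partial representation `π_α` of a partial action -/

section ofAction

open PartialAction PartialAction.CrossedProduct

variable {K G A : Type*} [Field K] [Group G] [Ring A] [Algebra K A]

/-- The partial representation `π_α : g ↦ 1_g δ_g` of `G` into the crossed product. -/
def ofAction (α : PartialAction K G A) (hα : α.HasUnities) :
    PartialRep G (α.CrossedProduct hα) where
  toFun g := delta α hα g ⟨α.unity hα g, α.unity_mem hα g⟩
  map_one := by
    rw [one_def]
    exact delta_congr rfl _ _ (α.unity_one hα)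
  mul_mul_inv g h := by
    have e1 : ∀ k : G, α.act k⁻¹ (α.unity hα k) = α.unity hα k⁻¹ := fun k => by
      have := α.act_unity hα k⁻¹ 1
      rwa [α.unity_one hα, inv_inv, mul_one, mul_one,
        α.mul_unity hα (α.unity_mem hα _)] at this
    simp only [delta_mul_delta]
    refine delta_congr rfl _ _ ?_
    simp only [coeffMul_coe, e1]
    rw [α.act_unity hα g h, α.act_unity hα (g * h) h⁻¹]
    have e2 : α.unity hα g * α.unity hα (g * h) = α.unity hα (g * h) * α.unity hα g :=
      IsUnity.eq (α.unity_inter hα g (g * h)) (by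
        rw [inf_comm]; exact α.unity_inter hα (g * h) g)
    have e3 : α.act (g * h)⁻¹ (α.unity hα g * α.unity hα (g * h)) =
        α.unity hα (g * h)⁻¹ * α.unity hα h⁻¹ := by
      have := α.act_unity hα (g * h)⁻¹ g
      rw [inv_inv] at this
      rw [e2, this]
      simp
    rw [e3, mul_assoc, α.mul_unity hα (α.unity_mem hα _), α.act_unity hα (g * h) h⁻¹]
  inv_mul_mul g h := by
    have e1 : ∀ k : G, α.act k⁻¹ (α.unity hα k) = α.unity hα k⁻¹ := fun k => by
      have := α.act_unity hα k⁻¹ 1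
      rwa [α.unity_one hα, inv_inv, mul_one, mul_one,
        α.mul_unity hα (α.unity_mem hα _)] at this
    simp only [delta_mul_delta]
    refine delta_congr (by group) _ _ ?_
    simp only [coeffMul_coe, e1]
    rw [α.act_unity hα g⁻¹ g, α.act_unity hα g⁻¹ (g * h), inv_mul_cancel, α.unity_one hα,
      inv_mul_cancel_left, inv_one, α.act_one, mul_one, α.act_one]

end ofAction

/-! ### The partial action `α^π` of a partial representation -/

section toAction

variable {K G B : Type*} [Field K] [Group G] [Ring B] [Algebra K B]

/-- `ε_g = π(g) π(g⁻¹)` -/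
def eps (π : PartialRep G B) (g : G) : B := π g * π g⁻¹

variable (π : PartialRep G B)

theorem eps_def (g : G) : π.eps g = π g * π g⁻¹ := rfl

theorem mul_inv_mul (g : G) : π g * π g⁻¹ * π g = π g := by
  have := π.inv_mul_mul g⁻¹ g
  rwa [inv_inv, inv_mul_cancel, π.map_one, mul_one] at this

theorem mul_eps (g h : G) : π g * π.eps h = π.eps (g * h) * π g := by
  have := π.inv_mul_mul (g * h)⁻¹ g
  rw [inv_inv] at this
  rw [eps_def, eps_def, this, ← mul_assoc, π.mul_mul_inv]
  congr 2
  group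

theorem eps_mul (g h : G) : π.eps h * π g = π g * π.eps (g⁻¹ * h) := by
  rw [mul_eps, mul_inv_cancel_left]

theorem eps_comm (g h : G) : π.eps g * π.eps h = π.eps h * π.eps g := by
  rw [eps_def π g, mul_assoc, mul_eps, ← mul_assoc, mul_eps, mul_inv_cancel_left, mul_assoc]

theorem eps_mul_self (g : G) : π.eps g * π.eps g = π.eps g := by
  rw [eps_def, ← mul_assoc, mul_inv_mul]

theorem eps_inv (g : G) : π.eps g⁻¹ = π g⁻¹ * π g := by
  rw [eps_def, inv_inv]

variable (K)

/-- The subalgebra of `B` generated by all `ε_g`. -/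
def epsAlg : Subalgebra K B := Algebra.adjoin K (Set.range π.eps)

variable {K}

theorem eps_mem (g : G) : π.eps g ∈ π.epsAlg K := Algebra.subset_adjoin ⟨g, rfl⟩

theorem eps_commute {a : B} (ha : a ∈ π.epsAlg K) (g : G) : π.eps g * a = a * π.eps g := by
  induction ha using Algebra.adjoin_induction with
  | mem x hx =>
    obtain ⟨h, rfl⟩ := hx
    exact π.eps_comm g h
  | algebraMap r => exact (Algebra.commutes r _).symm
  | add x y _ _ hx hy => rw [mul_add, add_mul, hx, hy]
  | mul x y _ _ hx hy => rw [← mul_assoc, hx, mul_assoc, hy, mul_assoc]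

theorem exists_mul_eq {a : B} (ha : a ∈ π.epsAlg K) (g : G) :
    ∃ b ∈ π.epsAlg K, π g * a = b * π g := by
  induction ha using Algebra.adjoin_induction with
  | mem x hx =>
    obtain ⟨h, rfl⟩ := hx
    exact ⟨_, π.eps_mem (g * h), π.mul_eps g h⟩
  | algebraMap r => exact ⟨_, Subalgebra.algebraMap_mem _ r, (Algebra.commutes r _).symm⟩
  | add x y _ _ hx hy =>
    obtain ⟨b, hb, hx⟩ := hx
    obtain ⟨c, hc, hy⟩ := hy
    exact ⟨b + c, Subalgebra.add_mem _ hb hc, by rw [mul_add, add_mul, hx, hy]⟩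
  | mul x y _ _ hx hy =>
    obtain ⟨b, hb, hx⟩ := hx
    obtain ⟨c, hc, hy⟩ := hy
    exact ⟨b * c, Subalgebra.mul_mem _ hb hc, by rw [← mul_assoc, hx, mul_assoc, hy, mul_assoc]⟩

theorem conj_mem {a : B} (ha : a ∈ π.epsAlg K) (g : G) : π g * a * π g⁻¹ ∈ π.epsAlg K := by
  obtain ⟨b, hb, h⟩ := π.exists_mul_eq ha g
  rw [h, mul_assoc]
  exact Subalgebra.mul_mem _ hb (π.eps_mem g)

variable (K)

/-- The ideal `D_g = ε_g A` of the subalgebra `A` generated by all `ε_g`. -/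
def dom (g : G) : Submodule K (π.epsAlg K) :=
  LinearMap.range (LinearMap.mulLeft K (⟨π.eps g, π.eps_mem g⟩ : π.epsAlg K))

variable {K}

theorem mem_dom {g : G} {x : π.epsAlg K} : x ∈ π.dom K g ↔ π.eps g * (x : B) = x := by
  constructor
  · rintro ⟨y, rfl⟩
    simp [← mul_assoc, eps_mul_self]
  · intro h
    exact ⟨x, Subtype.ext h⟩

/-- `a ↦ π(g) a π(g⁻¹)` on the subalgebra generated by all `ε_g`. -/
def conj (g : G) (x : π.epsAlg K) : π.epsAlg K := ⟨π g * x * π g⁻¹, π.conj_mem x.2 g⟩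

theorem conj_coe (g : G) (x : π.epsAlg K) : (π.conj g x : B) = π g * x * π g⁻¹ := rfl

theorem conj_mem_dom (g : G) (x : π.epsAlg K) : π.conj g x ∈ π.dom K g := by
  rw [mem_dom, conj_coe, eps_def, ← mul_assoc, ← mul_assoc, mul_inv_mul]

theorem conj_inv_conj {g : G} {x : π.epsAlg K} (hx : x ∈ π.dom K g⁻¹) :
    π.conj g⁻¹ (π.conj g x) = x := by
  refine Subtype.ext ?_
  have h : π g⁻¹ * (π g * (x : B) * π g⁻¹) * π g =
      π.eps g⁻¹ * ((x : B) * π.eps g⁻¹) := by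
    rw [eps_inv]
    simp only [mul_assoc]
  rw [conj_coe, conj_coe, inv_inv, h, ← π.eps_commute x.2, ← mul_assoc, eps_mul_self,
    (π.mem_dom).1 hx]

variable (K)

/-- The partial action `α^π` of `G` on the subalgebra generated by all `ε_g`:
`α_g (a) = π(g) a π(g⁻¹)` for `a ∈ D_{g⁻¹} = ε_{g⁻¹} A`. -/
def toAction : PartialAction K G (π.epsAlg K) where
  D := π.dom K
  mul_mem_left g a x hx := by
    rw [mem_dom] at hx ⊢
    rw [Subalgebra.coe_mul, ← mul_assoc, π.eps_commute a.2, mul_assoc, hx]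
  mul_mem_right g a x hx := by
    rw [mem_dom] at hx ⊢
    rw [Subalgebra.coe_mul, ← mul_assoc, hx]
  act := π.conj
  bijOn g := by
    refine Set.InvOn.bijOn (f' := π.conj g⁻¹) ⟨fun x hx => π.conj_inv_conj hx, fun x hx => ?_⟩
      (fun x _ => π.conj_mem_dom g x) (fun x _ => π.conj_mem_dom g⁻¹ x)
    have := π.conj_inv_conj (g := g⁻¹) (x := x) (by rwa [inv_inv])
    rwa [inv_inv] at this
  map_add g x y _ _ := Subtype.ext (by simp [conj_coe, mul_add, add_mul])
  map_smul g c x _ := Subtype.ext (by simp [conj_coe])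
  map_mul g x y hx hy := by
    refine Subtype.ext ?_
    have h : π g * (x : B) * π g⁻¹ * (π g * (y : B) * π g⁻¹) =
        π g * ((x : B) * (π.eps g⁻¹ * (y : B))) * π g⁻¹ := by
      rw [eps_inv]
      simp only [mul_assoc]
    rw [Subalgebra.coe_mul, conj_coe, conj_coe, conj_coe, h, (π.mem_dom).1 hy]
    rfl
  D_one := by
    refine eq_top_iff.2 fun x _ => (π.mem_dom).2 ?_
    simp [eps_def, π.map_one]
  act_one x := Subtype.ext (by simp [conj_coe, π.map_one])
  mem_of_act_mem g h x hx hx' := by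
    rw [mem_dom, conj_coe] at hx'
    have h1 := congrArg Subtype.val (π.conj_inv_conj hx)
    rw [conj_coe, conj_coe, inv_inv] at h1
    rw [mem_dom, ← h1, ← mul_assoc, ← mul_assoc (π.eps _), mul_inv_rev, ← mul_eps,
      mul_assoc (π h⁻¹) (π.eps g⁻¹), hx']
  act_act g h x hx _ := by
    refine Subtype.ext ?_
    have hx1 := (π.mem_dom).1 hx
    have hx2 : (x : B) * π.eps h⁻¹ = x := by rw [← π.eps_commute x.2, hx1]
    have e1 : π g * π h * π.eps h⁻¹ = π (g * h) * π.eps h⁻¹ := by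
      rw [eps_inv, ← mul_assoc, π.mul_mul_inv, mul_assoc]
    have e2 : π.eps h⁻¹ * (π h⁻¹ * π g⁻¹) = π.eps h⁻¹ * π (g * h)⁻¹ := by
      have := π.inv_mul_mul h (h⁻¹ * g⁻¹)
      have h3 := π.inv_mul_mul h⁻¹ g⁻¹
      rw [eps_inv, mul_inv_rev, this, mul_inv_cancel_left, ← mul_assoc]
      have h4 := π.mul_inv_mul h⁻¹
      rw [inv_inv] at h4
      rw [h4]
    rw [conj_coe, conj_coe, conj_coe]
    calc π g * (π h * (x : B) * π h⁻¹) * π g⁻¹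
        = π g * π h * (π.eps h⁻¹ * x * π.eps h⁻¹) * (π h⁻¹ * π g⁻¹) := by
          rw [hx1, hx2]; simp only [mul_assoc]
      _ = (π g * π h * π.eps h⁻¹) * x * (π.eps h⁻¹ * (π h⁻¹ * π g⁻¹)) := by
          simp only [mul_assoc]
      _ = π (g * h) * (π.eps h⁻¹ * x * π.eps h⁻¹) * π (g * h)⁻¹ := by
          rw [e1, e2]; simp only [mul_assoc]
      _ = π (g * h) * x * π (g * h)⁻¹ := by rw [hx1, hx2]

end toAction

end PartialRep

/-! ### Elementary partial representations -/

section elementary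

variable {G : Type*} [Group G]

/-- The index `(A : H)`: the number of right cosets `H a` with `a ∈ A`. -/
def cosetIndex (A : Set G) (H : Subgroup G) : ℕ∞ :=
  ((fun a : G => (H : Set G) * {a}) '' A).encard

/-- The choices that determine an elementary partial representation `G → M_n(KH)`: a set `A ∋ 1`
with `St(A) = H` and `(A : H) = n`, an enumeration `A_1 = A, ..., A_n` (here with indices
`0, ..., n - 1`) of the distinct sets `g A`, `g⁻¹ ∈ A`, and elements `g_i` with `g_i A = A_i`. -/
structure ElementaryDatum (H : Subgroup G) (n : ℕ) [NeZero n] where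
  A : Fin n → Set G
  one_mem : (1 : G) ∈ A 0
  stabilizer_eq : MulAction.stabilizer G (A 0) = H
  index_eq : cosetIndex (A 0) H = n
  injective : Function.Injective A
  range_eq : Set.range A = {S : Set G | ∃ g : G, g⁻¹ ∈ A 0 ∧ S = g • A 0}
  /-- the elements `g_i` -/
  rep : Fin n → G
  rep_smul : ∀ i, rep i • A 0 = A i

namespace ElementaryDatum

variable {H : Subgroup G} {n : ℕ} [NeZero n] (d : ElementaryDatum H n)

/-- The morphisms `(A_i, g) : A_i → A_j` of the groupoid `Γ`, with `g A_i = A_j`. -/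
structure Mor where
  src : Fin n
  tgt : Fin n
  elt : G
  smul_eq : elt • d.A src = d.A tgt

variable {d} in
theorem Mor.mem (γ : d.Mor) : (d.rep γ.tgt)⁻¹ * γ.elt * d.rep γ.src ∈ H := by
  refine d.stabilizer_eq.le (MulAction.mem_stabilizer_iff.2 ?_)
  rw [mul_smul, mul_smul, d.rep_smul, γ.smul_eq, ← d.rep_smul γ.tgt, inv_smul_smul]

theorem exists_tgt {i : Fin n} {g : G} (h : g⁻¹ ∈ d.A i) : ∃ j, g • d.A i = d.A j := by
  have h1 : (g * d.rep i)⁻¹ ∈ d.A 0 := by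
    rw [← d.rep_smul i, Set.mem_smul_set_iff_inv_smul_mem, smul_eq_mul] at h
    rwa [mul_inv_rev]
  have h2 : g • d.A i ∈ Set.range d.A := by
    rw [d.range_eq]
    exact ⟨g * d.rep i, h1, by rw [mul_smul, d.rep_smul]⟩
  obtain ⟨j, hj⟩ := h2
  exact ⟨j, hj.symm⟩

/-- The morphism `(A_i, g)` for `g⁻¹ ∈ A_i`. -/
def mor (i : Fin n) (g : G) (h : g⁻¹ ∈ d.A i) : d.Mor :=
  ⟨i, (d.exists_tgt h).choose, g, (d.exists_tgt h).choose_spec⟩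

variable (K : Type*) [Field K]

open Classical in
/-- `λ(g) = ∑_{A_i ∋ g⁻¹} (A_i, g)`, an element of the groupoid algebra `KΓ`, the vector space with
basis the morphisms of `Γ` (the multiplication of `KΓ` does not enter `τ ∘ λ`). -/
def lam (g : G) : d.Mor →₀ K :=
  ∑ i : Fin n, if h : g⁻¹ ∈ d.A i then Finsupp.single (d.mor i g h) 1 else 0

/-- The linear map `τ : KΓ → M_n(KH)`, `(A_i, g) ↦ e_{j,i}(g_j⁻¹ g g_i)` for `g A_i = A_j`. -/
def tau : (d.Mor →₀ K) →ₗ[K] Matrix (Fin n) (Fin n) (MonoidAlgebra K H) :=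
  Finsupp.linearCombination K fun γ : d.Mor =>
    Matrix.single γ.tgt γ.src (MonoidAlgebra.single ⟨_, γ.mem⟩ (1 : K))

theorem tau_single (γ : d.Mor) : d.tau K (Finsupp.single γ 1) =
    Matrix.single γ.tgt γ.src (MonoidAlgebra.single ⟨_, γ.mem⟩ (1 : K)) := by
  rw [tau, Finsupp.linearCombination_single, one_smul]

theorem tau_lam_eq_zero {g : G} {k i : Fin n} (h : g • d.A i ≠ d.A k) :
    d.tau K (d.lam K g) k i = 0 := by
  rw [lam, map_sum, Matrix.sum_apply]
  refine Finset.sum_eq_zero fun j _ => ?_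
  split_ifs with hj
  · rw [tau_single]
    refine Matrix.single_apply_of_ne _ _ _ _ _ ?_
    rintro ⟨rfl, h2⟩
    refine h ?_
    have h3 : j = i := h2
    subst h3
    exact (d.mor j g hj).smul_eq
  · simp

theorem tau_lam_eq_single {g : G} {k i : Fin n} (h : g • d.A i = d.A k) (x : H)
    (hx : (x : G) = (d.rep k)⁻¹ * g * d.rep i) :
    d.tau K (d.lam K g) k i = MonoidAlgebra.single x 1 := by
  have h1 : g⁻¹ ∈ d.A i := by
    have h2 : (d.rep k)⁻¹ * (d.rep k) ∈ d.A 0 := by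
      rw [inv_mul_cancel]
      exact d.one_mem
    have h3 : (1 : G) ∈ d.A k := by
      have : d.A k ∈ Set.range d.A := ⟨k, rfl⟩
      rw [d.range_eq] at this
      obtain ⟨g', hg', hk⟩ := this
      rw [hk, Set.mem_smul_set_iff_inv_smul_mem, smul_eq_mul, mul_one]
      exact hg'
    rw [← h, Set.mem_smul_set_iff_inv_smul_mem, smul_eq_mul, mul_one] at h3
    exact h3
  rw [lam, map_sum, Matrix.sum_apply, Finset.sum_eq_single i]
  · rw [dif_pos h1, tau_single]
    have h4 : (d.mor i g h1).tgt = k := d.injective (by rw [← (d.mor i g h1).smul_eq, ← h]; rfl)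
    rw [Matrix.single_apply, if_pos ⟨h4, rfl⟩]
    congr 1
    refine Subtype.ext ?_
    rw [hx]
    simp only [h4]
    rfl
  · intro j _ hj
    split_ifs with hj'
    · rw [tau_single]
      exact Matrix.single_apply_of_ne _ _ _ _ _ fun h => hj h.2
    · simp
  · simp

theorem tau_lam_mul (g h : G) (k j i : Fin n) (hh : h • d.A i = d.A j ∨ g • d.A j = d.A k) :
    d.tau K (d.lam K g) k j * d.tau K (d.lam K h) j i = d.tau K (d.lam K (g * h)) k i := by
  by_cases h1 : h • d.A i = d.A j
  · by_cases h2 : g • d.A j = d.A k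
    · rw [d.tau_lam_eq_single K h1 ⟨_, Mor.mem (d := d) ⟨i, j, h, h1⟩⟩ rfl,
        d.tau_lam_eq_single K h2 ⟨_, Mor.mem (d := d) ⟨j, k, g, h2⟩⟩ rfl,
        MonoidAlgebra.single_mul_single, mul_one]
      refine (d.tau_lam_eq_single K (by rw [mul_smul, h1, h2]) _ ?_).symm
      rw [Subgroup.coe_mul]
      group
    · rw [d.tau_lam_eq_zero K h2, zero_mul, d.tau_lam_eq_zero K]
      rwa [mul_smul, h1]
  · have h2 := hh.resolve_left h1
    rw [d.tau_lam_eq_zero K h1, mul_zero, d.tau_lam_eq_zero K]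
    rw [mul_smul, ← h2]
    exact fun h3 => h1 (smul_left_cancel g h3)

theorem mul_tau_lam (M : Matrix (Fin n) (Fin n) (MonoidAlgebra K H)) (h : G) (k j i : Fin n)
    (hh : h • d.A i = d.A j) :
    (M * d.tau K (d.lam K h)) k i = M k j * d.tau K (d.lam K h) j i := by
  rw [Matrix.mul_apply, Finset.sum_eq_single j _ (by simp)]
  intro l _ hl
  rw [d.tau_lam_eq_zero K, mul_zero]
  rw [hh]
  exact fun h' => hl (d.injective h').symm

theorem mul_tau_lam_zero (M : Matrix (Fin n) (Fin n) (MonoidAlgebra K H)) (h : G) (k i : Fin n)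
    (hh : ∀ j, h • d.A i ≠ d.A j) : (M * d.tau K (d.lam K h)) k i = 0 := by
  rw [Matrix.mul_apply]
  exact Finset.sum_eq_zero fun j _ => by rw [d.tau_lam_eq_zero K (hh j), mul_zero]

theorem tau_lam_mul_row (M : Matrix (Fin n) (Fin n) (MonoidAlgebra K H)) (g : G) (k j i : Fin n)
    (hg : g • d.A j = d.A k) :
    (d.tau K (d.lam K g) * M) k i = d.tau K (d.lam K g) k j * M j i := by
  rw [Matrix.mul_apply, Finset.sum_eq_single j _ (by simp)]
  intro l _ hl
  rw [d.tau_lam_eq_zero K, zero_mul]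
  rw [← hg]
  exact fun h' => hl (d.injective (smul_left_cancel g h'))

theorem tau_lam_mul_row_zero (M : Matrix (Fin n) (Fin n) (MonoidAlgebra K H)) (g : G)
    (k i : Fin n) (hg : ∀ j, g • d.A j ≠ d.A k) : (d.tau K (d.lam K g) * M) k i = 0 := by
  rw [Matrix.mul_apply]
  exact Finset.sum_eq_zero fun j _ => by rw [d.tau_lam_eq_zero K (hg j), zero_mul]

/-- The elementary partial representation `τ ∘ λ`. -/
def partialRep : PartialRep G (Matrix (Fin n) (Fin n) (MonoidAlgebra K H)) where
  toFun g := d.tau K (d.lam K g)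
  map_one := by
    ext1 k i
    by_cases h : k = i
    · subst h
      rw [d.tau_lam_eq_single K (one_smul G _) 1 (by simp), Matrix.one_apply_eq]
      rfl
    · rw [Matrix.one_apply_ne h, d.tau_lam_eq_zero K]
      rw [one_smul]
      exact fun h' => h (d.injective h').symm
  mul_mul_inv g h := by
    ext1 k i
    by_cases hh : ∃ j, h⁻¹ • d.A i = d.A j
    · obtain ⟨j, hj⟩ := hh
      have hj' : h • d.A j = d.A i := by rw [← hj, smul_inv_smul]
      rw [d.mul_tau_lam K _ _ k j i hj, d.mul_tau_lam K _ _ k j i hj,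
        d.mul_tau_lam K _ _ k i j hj', d.tau_lam_mul K g h k i j (Or.inl hj')]
    · push Not at hh
      rw [d.mul_tau_lam_zero K _ _ k i hh, d.mul_tau_lam_zero K _ _ k i hh]
  inv_mul_mul g h := by
    ext1 k i
    rw [mul_assoc]
    by_cases hg : ∃ j, g⁻¹ • d.A j = d.A k
    · obtain ⟨j, hj⟩ := hg
      have hj' : g • d.A k = d.A j := by rw [← hj, smul_inv_smul]
      rw [d.tau_lam_mul_row K _ _ k j i hj, d.tau_lam_mul_row K _ _ k j i hj,
        d.tau_lam_mul_row K _ _ j k i hj', d.tau_lam_mul K g h j k i (Or.inr hj')]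
    · push Not at hg
      rw [d.tau_lam_mul_row_zero K _ _ k i hg, d.tau_lam_mul_row_zero K _ _ k i hg]

end ElementaryDatum

variable (K : Type*) [Field K]

/-- The elementary partial representations `π : G → M_n(KH)`. -/
def IsElementary {H : Subgroup G} {n : ℕ} [NeZero n]
    (π : PartialRep G (Matrix (Fin n) (Fin n) (MonoidAlgebra K H))) : Prop :=
  ∃ d : ElementaryDatum H n, π = d.partialRep K

/-- The equivalence classes of elementary partial representations `G → M_n(KH)`. -/
def elementarySetoid (H : Subgroup G) (n : ℕ) [NeZero n] :
    Setoid {π : PartialRep G (Matrix (Fin n) (Fin n) (MonoidAlgebra K H)) // IsElementary K π} where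
  r π π' := PartialRep.Equivalent K π.1 π'.1
  iseqv := ⟨fun π => .refl π.1, fun h => h.symm, fun h h' => h.trans h'⟩

end elementary

/-! ### Partial actions on `K^n` -/

section Kn

variable {K G : Type*} [Field K] [Group G] {n : ℕ}

/-- Every ideal of `K^n` is a unital algebra. -/
theorem hasUnities (α : PartialAction K G (Fin n → K)) : α.HasUnities := by
  classical
  intro g
  refine ⟨∑ i, if ∃ x ∈ α.D g, x i ≠ 0 then Pi.single i 1 else 0, ?_, ?_⟩
  · refine Submodule.sum_mem _ fun i _ => ?_
    split_ifs with h
    · obtain ⟨x, hx, hi⟩ := h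
      have h2 : (Pi.single i 1 : Fin n → K) = Pi.single i (x i)⁻¹ * x := by
        ext j
        by_cases hj : j = i
        · subst hj
          simp [hi]
        · simp [hj]
      rw [h2]
      exact α.mul_mem_left _ _ hx
    · exact Submodule.zero_mem _
  · intro x hx
    have h : (∑ i, if ∃ x ∈ α.D g, x i ≠ 0 then Pi.single i 1 else 0 : Fin n → K) * x = x := by
      ext j
      rw [Pi.mul_apply, Finset.sum_apply, Finset.sum_eq_single j]
      · by_cases hj : x j = 0
        · simp [hj]
        · rw [if_pos ⟨x, hx, hj⟩]
          simp
      · intro i _ hij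
        split_ifs
        · exact Pi.single_eq_of_ne hij.symm _
        · rfl
      · simp
    exact ⟨h, by rw [mul_comm, h]⟩

/-- `A_i(α) = {g ∈ G : (1_g)_i ≠ 0}` -/
def supportSet (α : PartialAction K G (Fin n → K)) (i : Fin n) : Set G :=
  {g | α.unity (hasUnities α) g i ≠ 0}

/-- The conditions `St(A_1(α)) = H` and `(A_1(α) : H) = n` on a partial action of `G` on `K^n`
(the first coordinate has index `0`). -/
def HasIsotropy [NeZero n] (H : Subgroup G) (α : PartialAction K G (Fin n → K)) : Prop :=
  MulAction.stabilizer G (supportSet α 0) = H ∧ cosetIndex (supportSet α 0) H = n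

variable (K)

/-- The equivalence classes of partial actions `α` of `G` on `K^n` with `St(A_1(α)) = H` and
`(A_1(α) : H) = n`. -/
def actionSetoid (H : Subgroup G) (n : ℕ) [NeZero n] :
    Setoid {α : PartialAction K G (Fin n → K) // HasIsotropy H α} where
  r α α' := PartialAction.Equivalent α.1 α'.1
  iseqv := ⟨fun α => .refl α.1, fun h => h.symm, fun h h' => h.trans h'⟩

end Kn

end PartialActions

end

/-! An elementary datum is a groupoid on the `n` sets `A_i`, with an arrow `g` from `A_j` to `A_i`
whenever `g A_j = A_i`, and `g ∈ A_i` exactly when some arrow labelled `g` ends at `A_i`. Hence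
`ε_g` is the diagonal 0/1 matrix supported on `{i : g ∈ A_i}`. As the `A_i` are distinct, the `ε_g`
separate the indices and generate the whole diagonal (`range_diag`), and `α^π` sends `e_j` to `e_i`
along such arrows.

The map `a δ_g ↦ a π(g)` sends `e_k δ_g` to the matrix unit `e_{k,i}(t)` with `t = g_k⁻¹ g g_i`, and
`g = g_k t g_i⁻¹` is recovered from `(k, i, t)`. It therefore matches a basis of the crossed product
with a basis of `M_n(KH)`, which makes `π` equivalent to the partial representation of `α^π`
(`equivalent_ofAction_toAction`).

Conversely, a partial action on `K^n` permutes primitive idempotents partially (`exists_moves`), and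
`g A_j(α) = A_i(α)` if `g` moves `j` to `i`. Elements of `A_1(α)` in different right cosets of `H`
start at different points, so `n` cosets exhaust the `n` points: the action is transitive with
distinct `A_i(α)` (`exists_moves_zero`). These sets form an elementary datum and determine `α`
(`isEquivalence_diagEquiv`). Functoriality of both constructions gives the rest. -/

noncomputable section

namespace PartialActions

/-! ### Functoriality of both constructions under equivalence -/

section functoriality

variable {K G : Type*} [Field K] [Group G]

/-- Equivalent partial representations have equivalent partial actions. -/
theorem PartialRep.Equivalent.toAction {B B' : Type*} [Ring B] [Algebra K B] [Ring B']
    [Algebra K B']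
    {π : PartialRep G B} {π' : PartialRep G B'} (h : PartialRep.Equivalent K π π') :
    PartialAction.Equivalent (π.toAction K) (π'.toAction K) := by
  obtain ⟨φ, h⟩ := h.symm
  have heps : ∀ g, φ (π.eps g) = π'.eps g := fun g => by
    rw [PartialRep.eps_def, PartialRep.eps_def, map_mul, h, h]
  have hmap : (π.epsAlg K).map (φ : B →ₐ[K] B') = π'.epsAlg K := by
    rw [PartialRep.epsAlg, PartialRep.epsAlg, AlgHom.map_adjoin, ← Set.range_comp]
    congr 2
    exact funext heps
  let ψ : π.epsAlg K ≃ₐ[K] π'.epsAlg K :=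
    (φ.subalgebraMap (π.epsAlg K)).trans (Subalgebra.equivOfEq _ _ hmap)
  have hψ : ∀ x : π.epsAlg K, (ψ x : B') = φ x := fun x => rfl
  refine ⟨ψ, fun g => ?_, fun g x _ => Subtype.ext ?_⟩
  · ext y
    obtain ⟨x, rfl⟩ := ψ.surjective y
    rw [ψ.injective.mem_set_image]
    refine (π.mem_dom).trans (Iff.trans ?_ (π'.mem_dom).symm)
    rw [hψ, ← heps, ← map_mul, φ.injective.eq_iff]
  · rw [hψ]
    change π' g * (ψ x : B') * π' g⁻¹ = φ (π g * x * π g⁻¹)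
    rw [hψ, map_mul, map_mul, h, h]

namespace PartialAction

variable {A A' : Type*} [Ring A] [Algebra K A] [Ring A'] [Algebra K A']

open CrossedProduct

/-- A linear map out of the crossed product which is multiplicative on the `a δ_g` and maps `1` to
`1` is an algebra homomorphism. -/
def CrossedProduct.liftAlgHom {B : Type*} [Ring B] [Algebra K B] (α : PartialAction K G A)
    (hα : α.HasUnities) (f : ∀ g : G, α.D g →ₗ[K] B)
    (hone : f 1 ⟨1, by rw [α.D_one]; trivial⟩ = 1)
    (hmul : ∀ g h (a : α.D g) (b : α.D h), f (g * h) (coeffMul α g h a b) = f g a * f h b) :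
    α.CrossedProduct hα →ₐ[K] B :=
  AlgHom.ofLinearMap (lift α hα f) (by rw [one_def, lift_delta, hone]) (by
    have key : (mulBilin α hα).compr₂ (lift α hα f) =
        (LinearMap.mul K B).compl₁₂ (lift α hα f) (lift α hα f) := by
      refine linearMap_ext fun g a => linearMap_ext fun h b => ?_
      change lift α hα f (delta α hα g a * delta α hα h b) =
        lift α hα f (delta α hα g a) * lift α hα f (delta α hα h b)
      rw [delta_mul_delta, lift_delta, lift_delta, lift_delta, hmul]
    exact fun x y => LinearMap.congr_fun (LinearMap.congr_fun key x) y)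

theorem CrossedProduct.liftAlgHom_delta {B : Type*} [Ring B] [Algebra K B] {α : PartialAction K G A}
    {hα : α.HasUnities} {f : ∀ g : G, α.D g →ₗ[K] B} {hone hmul} (g : G) (a : α.D g) :
    liftAlgHom α hα f hone hmul (delta α hα g a) = f g a :=
  lift_delta f g a

theorem CrossedProduct.algHom_ext {B : Type*} [Ring B] [Algebra K B] {α : PartialAction K G A}
    {hα : α.HasUnities} {f f' : α.CrossedProduct hα →ₐ[K] B}
    (h : ∀ g a, f (delta α hα g a) = f' (delta α hα g a)) : f = f' :=
  AlgHom.toLinearMap_injective (linearMap_ext h)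

theorem IsEquivalence.mem {φ : A ≃ₐ[K] A'} {α : PartialAction K G A} {α' : PartialAction K G A'}
    (h : IsEquivalence φ α α') {g : G} {x : A} (hx : x ∈ α.D g) : φ x ∈ α'.D g := by
  have : φ x ∈ (α'.D g : Set A') := h.1 g ▸ Set.mem_image_of_mem φ hx
  exact this

theorem IsEquivalence.symm {φ : A ≃ₐ[K] A'} {α : PartialAction K G A} {α' : PartialAction K G A'}
    (h : IsEquivalence φ α α') : IsEquivalence φ.symm α' α := by
  refine ⟨fun g => ?_, fun g x hx => ?_⟩
  · rw [← h.1 g, Set.image_image]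
    simp
  · have hx' : x ∈ (α'.D g⁻¹ : Set A') := hx
    rw [← h.1] at hx'
    obtain ⟨y, hy, rfl⟩ := hx'
    rw [h.2 g y hy]
    simp

theorem IsEquivalence.map_unity {φ : A ≃ₐ[K] A'} {α : PartialAction K G A}
    {α' : PartialAction K G A'} (h : IsEquivalence φ α α') {g : G} {e : A}
    (he : IsUnity (α.D g) e) : IsUnity (α'.D g) (φ e) := by
  refine ⟨h.mem he.1, fun x hx => ?_⟩
  have := he.2 _ (h.symm.mem hx)
  refine ⟨φ.symm.injective ?_, φ.symm.injective ?_⟩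
  · rw [_root_.map_mul, AlgEquiv.symm_apply_apply, this.1]
  · rw [_root_.map_mul, AlgEquiv.symm_apply_apply, this.2]

/-- The homomorphism of crossed products induced by an equivalence of partial actions. -/
def CrossedProduct.map {φ : A ≃ₐ[K] A'} {α : PartialAction K G A} {α' : PartialAction K G A'}
    (h : IsEquivalence φ α α') (hα : α.HasUnities) (hα' : α'.HasUnities) :
    α.CrossedProduct hα →ₐ[K] α'.CrossedProduct hα' :=
  liftAlgHom α hα
    (fun g => delta α' hα' g ∘ₗ φ.toLinearMap.restrict (p := α.D g) (q := α'.D g) fun _ => h.mem)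
    (by rw [one_def]; exact delta_congr rfl _ _ (map_one φ))
    (fun g k a b => by
      simp only [LinearMap.comp_apply]
      rw [delta_mul_delta]
      refine delta_congr rfl _ _ ?_
      rw [coeffMul_coe]
      have ha := α.mem_inv_inv a.2
      have hm := α.mul_mem_right _ (b : A) (α.act_inv_mem a.2)
      change φ (α.act g (α.act g⁻¹ a * b)) = α'.act g (α'.act g⁻¹ (φ a) * φ b)
      rw [h.2 g⁻¹ _ ha, ← _root_.map_mul, h.2 g _ hm])

theorem CrossedProduct.map_delta {φ : A ≃ₐ[K] A'} {α : PartialAction K G A}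
    {α' : PartialAction K G A'} (h : IsEquivalence φ α α') (hα : α.HasUnities)
    (hα' : α'.HasUnities) (g : G) (a : α.D g) :
    map h hα hα' (delta α hα g a) = delta α' hα' g ⟨φ a, h.mem a.2⟩ :=
  liftAlgHom_delta g a

/-- Equivalent partial actions have equivalent partial representations. -/
theorem Equivalent.ofAction {α : PartialAction K G A} {α' : PartialAction K G A'}
    (h : Equivalent α α') (hα : α.HasUnities) (hα' : α'.HasUnities) :
    PartialRep.Equivalent K (PartialRep.ofAction α hα) (PartialRep.ofAction α' hα') := by
  obtain ⟨φ, h⟩ := h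
  -- The isomorphism induced by `φ` starts at the crossed product by `α`, opposite to the direction
  -- in the definition of equivalence.
  refine PartialRep.Equivalent.symm ⟨AlgEquiv.ofAlgHom (map h hα hα') (map h.symm hα' hα)
    (algHom_ext fun g a => ?_) (algHom_ext fun g a => ?_), fun g => ?_⟩
  · rw [AlgHom.comp_apply, map_delta, map_delta]
    exact delta_congr rfl _ _ (φ.apply_symm_apply _)
  · rw [AlgHom.comp_apply, map_delta, map_delta]
    exact delta_congr rfl _ _ (φ.symm_apply_apply _)
  · change delta α' hα' g _ = map h hα hα' (delta α hα g _)
    rw [map_delta]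
    exact delta_congr rfl _ _ ((α'.unity_spec hα' g).eq (h.map_unity (α.unity_spec hα g)))

end PartialAction

/-! ### The homomorphism from the crossed product by `α^π` -/

namespace PartialRep

open PartialAction PartialAction.CrossedProduct

variable {B : Type*} [Ring B] [Algebra K B] (π : PartialRep G B)

theorem isUnity_eps (g : G) :
    IsUnity ((π.toAction K).D g) (⟨π.eps g, π.eps_mem g⟩ : π.epsAlg K) := by
  refine ⟨(π.mem_dom).2 (π.eps_mul_self g), fun x hx => ?_⟩
  have h := (π.mem_dom).1 hx
  exact ⟨Subtype.ext h, Subtype.ext ((π.eps_commute x.2 g).symm.trans h)⟩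

theorem hasUnities_toAction : (π.toAction K).HasUnities := fun g => ⟨_, π.isUnity_eps g⟩

variable (K)

/-- The homomorphism `a δ_g ↦ a π(g)` from the crossed product by the partial action `α^π`. -/
def crossedProductHom : (π.toAction K).CrossedProduct π.hasUnities_toAction →ₐ[K] B :=
  liftAlgHom (π.toAction K) π.hasUnities_toAction
    (fun g => LinearMap.mulRight K (π g) ∘ₗ (π.epsAlg K).val.toLinearMap ∘ₗ
      ((π.toAction K).D g).subtype)
    (by
      change (1 : B) * π 1 = 1
      rw [π.map_one, mul_one])
    (fun g h a b => by
      change π g * (π g⁻¹ * ((a : π.epsAlg K) : B) * π g⁻¹⁻¹ * ((b : π.epsAlg K) : B)) * π g⁻¹ *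
        π (g * h) = ((a : π.epsAlg K) : B) * π g * (((b : π.epsAlg K) : B) * π h)
      have ha : π.eps g * ((a : π.epsAlg K) : B) = ((a : π.epsAlg K) : B) := (π.mem_dom).1 a.2
      -- The last axiom replaces `π(g⁻¹) π(gh)` by `ε_{g⁻¹} π(h)`. The idempotent `ε_{g⁻¹}` commutes
      -- with `b` and is then absorbed by `π(g)`.
      have h1 := π.inv_mul_mul g h
      have h2 := π.eps_commute (b : π.epsAlg K).2 g⁻¹
      rw [eps_inv] at h2
      rw [mul_assoc _ (π g⁻¹) (π (g * h)), ← h1, inv_inv]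
      calc _ = π.eps g * ((a : π.epsAlg K) : B) * π g *
            (((b : π.epsAlg K) : B) * (π g⁻¹ * π g)) * π h := by
            rw [eps_def]; simp only [mul_assoc]
        _ = ((a : π.epsAlg K) : B) * (π g * π g⁻¹ * π g) * ((b : π.epsAlg K) : B) * π h := by
            rw [← h2, ha]; simp only [mul_assoc]
        _ = _ := by rw [mul_inv_mul]; simp only [mul_assoc])

theorem crossedProductHom_delta (g : G) (a : (π.toAction K).D g) :
    π.crossedProductHom K (delta _ π.hasUnities_toAction g a) = ((a : π.epsAlg K) : B) * π g :=
  liftAlgHom_delta g a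

variable {K}

/-- If `a δ_g ↦ a π(g)` is bijective then `π` is equivalent to the partial representation given by
the partial action `α^π`. -/
theorem equivalent_ofAction (h : Function.Bijective (π.crossedProductHom K)) :
    Equivalent K π (ofAction (π.toAction K) π.hasUnities_toAction) := by
  refine ⟨AlgEquiv.ofBijective _ h, fun g => ?_⟩
  change π g = π.crossedProductHom K (delta _ _ g _)
  rw [crossedProductHom_delta]
  -- The unity of `D_g` is `ε_g`, and `ε_g π(g) = π(g)`.
  have := ((π.toAction K).unity_spec π.hasUnities_toAction g).eq (π.isUnity_eps g)
  simp only [this]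
  rw [eps_def, mul_inv_mul]

end PartialRep

end functoriality

/-! ### The diagonal subalgebra and the partial action of an elementary partial representation -/

namespace ElementaryDatum

section diag

variable {G : Type*} [Group G] {H : Subgroup G} {n : ℕ} (K : Type*) [Field K]

variable (H n) in
/-- The diagonal embedding `K^n → M_n(KH)`. -/
def diag : (Fin n → K) →ₐ[K] Matrix (Fin n) (Fin n) (MonoidAlgebra K H) :=
  (Matrix.diagonalAlgHom K).comp ((Algebra.ofId K (MonoidAlgebra K H)).compLeft (Fin n))

theorem diag_apply (x : Fin n → K) :
    diag H n K x = Matrix.diagonal fun i => algebraMap K (MonoidAlgebra K H) (x i) := rfl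

theorem diag_apply_same (x : Fin n → K) (i : Fin n) :
    diag H n K x i i = algebraMap K (MonoidAlgebra K H) (x i) := by
  rw [diag_apply, Matrix.diagonal_apply_eq]

theorem diag_injective : Function.Injective (diag H n K) := fun x y h => funext fun i =>
  (algebraMap K (MonoidAlgebra K H)).injective <| by
    rw [← diag_apply_same, ← diag_apply_same, h]

theorem diag_mul_apply (x : Fin n → K) (M : Matrix (Fin n) (Fin n) (MonoidAlgebra K H))
    (k i : Fin n) : (diag H n K x * M) k i = x k • M k i := by
  rw [diag_apply, Matrix.diagonal_mul, Algebra.smul_def]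

theorem mul_diag_apply (x : Fin n → K) (M : Matrix (Fin n) (Fin n) (MonoidAlgebra K H))
    (k i : Fin n) : (M * diag H n K x) k i = x i • M k i := by
  rw [diag_apply, Matrix.mul_diagonal, Algebra.smul_def, Algebra.commutes]

end diag

variable {G : Type*} [Group G] {H : Subgroup G} {n : ℕ} [NeZero n] (d : ElementaryDatum H n)

theorem one_mem_A (i : Fin n) : (1 : G) ∈ d.A i := by
  have h : d.A i ∈ Set.range d.A := ⟨i, rfl⟩
  rw [d.range_eq] at h
  obtain ⟨g, hg, hi⟩ := h
  rw [hi, Set.mem_smul_set_iff_inv_smul_mem, smul_eq_mul, mul_one]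
  exact hg

/-- Translating `A_i` by the inverse of one of its members stays in the family, which gives the
source of an arrow `g`. Conversely `1 ∈ A_j` puts `g` into `g A_j`. -/
theorem mem_A_iff {i : Fin n} {g : G} : g ∈ d.A i ↔ ∃ j, g • d.A j = d.A i := by
  constructor
  · intro h
    obtain ⟨j, hj⟩ := d.exists_tgt (i := i) (g := g⁻¹) (by rwa [inv_inv])
    exact ⟨j, by rw [← hj, smul_inv_smul]⟩
  · rintro ⟨j, hj⟩
    rw [← hj, Set.mem_smul_set_iff_inv_smul_mem, smul_eq_mul, inv_mul_cancel]
    exact d.one_mem_A j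

variable (K : Type*) [Field K]

theorem partialRep_apply (g : G) : d.partialRep K g = d.tau K (d.lam K g) := rfl

open Classical in
/-- `ε_g` is the diagonal matrix with entries `1` at the positions `i` with `g ∈ A_i`. -/
theorem eps_partialRep (g : G) :
    (d.partialRep K).eps g = diag H n K fun i => if g ∈ d.A i then 1 else 0 := by
  ext1 k i
  rw [PartialRep.eps_def]
  simp only [partialRep_apply]
  -- Scaling the columns of the identity matrix describes the entry by `i` alone, so `k = i` and `k
  -- ≠ i` need not be separated.
  have hd : diag H n K (fun i => if g ∈ d.A i then 1 else 0) k i =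
      if g ∈ d.A i then (1 : Matrix (Fin n) (Fin n) (MonoidAlgebra K H)) k i else 0 := by
    rw [← mul_one (diag H n K _), ← one_mul (diag H n K _ * 1), mul_one, mul_diag_apply]
    split_ifs <;> simp
  rw [hd]
  split_ifs with h
  -- Column `i` of `π(g⁻¹)` is concentrated in row `j`, so the entry of the product agrees with that
  -- of `π(g g⁻¹) = 1`.
  · obtain ⟨j, hj⟩ := d.mem_A_iff.1 h
    have hj' : g⁻¹ • d.A i = d.A j := by rw [← hj, inv_smul_smul]
    rw [d.mul_tau_lam K _ _ k j i hj', d.tau_lam_mul K _ _ k j i (Or.inl hj'), mul_inv_cancel,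
      ← partialRep_apply, (d.partialRep K).map_one]
  · refine d.mul_tau_lam_zero K _ _ k i fun j hj => h (d.mem_A_iff.2 ⟨j, ?_⟩)
    rw [← hj, smul_inv_smul]

-- For `j ≠ i` some `g` lies in exactly one of `A_i` and `A_j`; then `ε_g` or `1 - ε_g` has entry 1
-- at `i` and 0 at `j`. The product of these elements over all `j ≠ i` is `e_i`.
open Classical in
theorem single_mem_comap_epsAlg (i : Fin n) :
    (Pi.single i 1 : Fin n → K) ∈ ((d.partialRep K).epsAlg K).comap (diag H n K) := by
  set S := ((d.partialRep K).epsAlg K).comap (diag H n K)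
  have hS : ∀ g, (fun i => if g ∈ d.A i then 1 else 0 : Fin n → K) ∈ S := fun g => by
    change diag H n K _ ∈ (d.partialRep K).epsAlg K
    rw [← eps_partialRep]
    exact (d.partialRep K).eps_mem g
  have hsep : ∀ j, j ≠ i → ∃ f ∈ S, f i = 1 ∧ f j = 0 := by
    intro j hj
    have hA : d.A i ≠ d.A j := fun h => hj (d.injective h).symm
    obtain ⟨g, hg⟩ : ∃ g, ¬ (g ∈ d.A i ↔ g ∈ d.A j) := by
      by_contra! h
      exact hA (Set.ext h)
    by_cases hi : g ∈ d.A i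
    · have hgj : g ∉ d.A j := fun h => hg ⟨fun _ => h, fun _ => hi⟩
      exact ⟨_, hS g, if_pos hi, if_neg hgj⟩
    · have hgj : g ∈ d.A j := by tauto
      exact ⟨_, S.sub_mem S.one_mem (hS g), by simp [hi], by simp [hgj]⟩
  choose! f hf hfi hfj using hsep
  have : (Pi.single i 1 : Fin n → K) = ∏ j ∈ Finset.univ.erase i, f j := by
    ext k
    rw [Finset.prod_apply]
    by_cases hk : k = i
    · subst hk
      rw [Pi.single_eq_same]
      exact (Finset.prod_eq_one fun j hj => hfi j (Finset.ne_of_mem_erase hj)).symm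
    · rw [Pi.single_eq_of_ne hk]
      exact (Finset.prod_eq_zero (Finset.mem_erase.2 ⟨hk, Finset.mem_univ k⟩)
        (by rw [hfj k hk])).symm
  rw [this]
  exact S.prod_mem fun j hj => hf j (Finset.ne_of_mem_erase hj)

/-- The subalgebra generated by all `ε_g` is the diagonal subalgebra. -/
theorem range_diag : (diag H n K).range = (d.partialRep K).epsAlg K := by
  classical
  refine le_antisymm ?_ (Algebra.adjoin_le ?_)
  · rintro _ ⟨x, rfl⟩
    change x ∈ ((d.partialRep K).epsAlg K).comap (diag H n K)
    rw [pi_eq_sum_univ' x]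
    refine Subalgebra.sum_mem _ fun i _ => Subalgebra.smul_mem _ ?_ _
    convert d.single_mem_comap_epsAlg K i using 1
  · rintro _ ⟨g, rfl⟩
    exact ⟨_, (d.eps_partialRep K g).symm⟩

/-- The identification of `K^n` with the subalgebra generated by all `ε_g`. -/
def diagEquiv : (Fin n → K) ≃ₐ[K] (d.partialRep K).epsAlg K :=
  (AlgEquiv.ofInjective (diag H n K) (diag_injective K)).trans
    (Subalgebra.equivOfEq _ _ (d.range_diag K))

theorem diagEquiv_coe (x : Fin n → K) :
    (d.diagEquiv K x : Matrix (Fin n) (Fin n) (MonoidAlgebra K H)) = diag H n K x := rfl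

theorem diagEquiv_mem_dom {x : Fin n → K} {g : G} :
    d.diagEquiv K x ∈ (d.partialRep K).dom K g ↔ ∀ i, g ∉ d.A i → x i = 0 := by
  classical
  rw [PartialRep.mem_dom, diagEquiv_coe, eps_partialRep, ← _root_.map_mul,
    (diag_injective K).eq_iff, funext_iff]
  refine forall_congr' fun i => ?_
  by_cases h : g ∈ d.A i <;> simp [h, eq_comm]

/-- The entry of `π(g)` at `(k, l)` vanishes unless `g A_l = A_k`. For such a pair, distinctness of
the sets makes `l = j` and `k = i` equivalent, so selecting column `j` or row `i` has the same
effect. -/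
theorem partialRep_mul_diag_single (g : G) {i j : Fin n} (h : g • d.A j = d.A i) :
    d.partialRep K g * diag H n K (Pi.single j 1) =
      diag H n K (Pi.single i 1) * d.partialRep K g := by
  ext1 k l
  rw [mul_diag_apply, diag_mul_apply, partialRep_apply]
  by_cases hkl : g • d.A l = d.A k
  · congr 1
    have : l = j ↔ k = i := by
      rw [← d.injective.eq_iff, ← d.injective.eq_iff, ← h, ← hkl, smul_left_cancel_iff]
    simp only [Pi.single_apply, this]
  · rw [d.tau_lam_eq_zero K hkl, smul_zero, smul_zero]

/-- Moving `e_j` across `π(g)` leaves `e_i ε_g`, which is `e_i` because `g ∈ A_i`. -/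
theorem conj_diagEquiv_single (g : G) {i j : Fin n} (h : g • d.A j = d.A i) :
    (d.partialRep K).conj g (d.diagEquiv K (Pi.single j 1)) = d.diagEquiv K (Pi.single i 1) := by
  classical
  refine Subtype.ext ?_
  rw [PartialRep.conj_coe, diagEquiv_coe, diagEquiv_coe, d.partialRep_mul_diag_single K g h,
    mul_assoc, ← PartialRep.eps_def, eps_partialRep, ← _root_.map_mul]
  congr 1
  ext k
  by_cases hk : k = i
  · subst hk
    simp [d.mem_A_iff.2 ⟨j, h⟩]
  · simp [hk]

open Classical in
/-- The value of `a ↦ a π(g)` at a single matrix entry and a single group element. -/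
theorem diag_mul_partialRep_apply (x : Fin n → K) (g : G) (k i : Fin n) (t : H) :
    ((diag H n K x * d.partialRep K g) k i).coeff t =
      if g = d.rep k * t * (d.rep i)⁻¹ then x k else 0 := by
  rw [diag_mul_apply, partialRep_apply, MonoidAlgebra.coeff_smul_apply]
  have hst : ∀ s ∈ H, s • d.A 0 = d.A 0 := fun s hs => by
    rw [← d.stabilizer_eq] at hs
    exact hs
  split_ifs with hg
  · have hg' : g • d.A i = d.A k := by
      rw [hg, mul_smul, mul_smul, ← d.rep_smul i, inv_smul_smul, hst _ t.2, d.rep_smul]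
    rw [d.tau_lam_eq_single K hg' t (by rw [hg]; group), MonoidAlgebra.coeff_single,
      Finsupp.single_apply, if_pos rfl, smul_eq_mul, mul_one]
  · by_cases hg' : g • d.A i = d.A k
    · rw [d.tau_lam_eq_single K hg' ⟨_, Mor.mem (d := d) ⟨i, k, g, hg'⟩⟩ rfl,
        MonoidAlgebra.coeff_single, Finsupp.single_apply, if_neg, smul_zero]
      rintro rfl
      exact hg (by group)
    · rw [d.tau_lam_eq_zero K hg', MonoidAlgebra.coeff_zero, Finsupp.zero_apply, smul_zero]

/-! ### The crossed product by `α^π` is the matrix algebra `M_n(KH)` -/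

open PartialAction PartialAction.CrossedProduct

/-- Since `(k, i, t)` determines `g`, each coefficient of the image matrix reads off one coordinate
of one component of `x`. Keeping `g` as a variable with an equation lets the lemma be applied to a
prescribed `g`. -/
theorem crossedProductHom_apply
    (x : ((d.partialRep K).toAction K).CrossedProduct (d.partialRep K).hasUnities_toAction)
    (k i : Fin n) (t : H) (g : G) (hg : g = d.rep k * t * (d.rep i)⁻¹) :
    ((d.partialRep K).crossedProductHom K x k i).coeff t =
      (d.diagEquiv K).symm (DirectSum.component K G
        (fun g => ((d.partialRep K).toAction K).D g) g x : (d.partialRep K).epsAlg K) k := by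
  classical
  subst hg
  -- Both sides become linear functionals of `x`, to be compared only on the `a δ_g`.
  let f₁ : ((d.partialRep K).toAction K).CrossedProduct (d.partialRep K).hasUnities_toAction →ₗ[K]
      K := (Finsupp.lapply t ∘ₗ (MonoidAlgebra.coeffLinearEquiv K).toLinearMap) ∘ₗ
        Matrix.entryLinearMap K (MonoidAlgebra K H) k i ∘ₗ
          ((d.partialRep K).crossedProductHom K).toLinearMap
  let f₂ : ((d.partialRep K).toAction K).CrossedProduct (d.partialRep K).hasUnities_toAction →ₗ[K]
      K := LinearMap.proj k ∘ₗ (d.diagEquiv K).symm.toLinearMap ∘ₗ Submodule.subtype _ ∘ₗ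
        DirectSum.component K G (fun g => ((d.partialRep K).toAction K).D g)
          (d.rep k * t * (d.rep i)⁻¹)
  have h : f₁ = f₂ := by
    refine linearMap_ext fun g a => ?_
    obtain ⟨a, ha⟩ := a
    obtain ⟨y, rfl⟩ := (d.diagEquiv K).surjective a
    change ((d.partialRep K).crossedProductHom K (delta _ _ g _) k i).coeff t =
      (d.diagEquiv K).symm (DirectSum.component K G (fun g => ((d.partialRep K).toAction K).D g)
        (d.rep k * t * (d.rep i)⁻¹)
          (DirectSum.lof K G (fun g => ((d.partialRep K).toAction K).D g) g _) :
          (d.partialRep K).epsAlg K) k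
    rw [PartialRep.crossedProductHom_delta, diagEquiv_coe, diag_mul_partialRep_apply]
    split_ifs with hg
    · subst hg
      rw [DirectSum.component.lof_self, AlgEquiv.symm_apply_apply]
    · rw [DirectSum.component.of, dif_neg hg]
      simp
  exact LinearMap.congr_fun h x

/-- Coordinate `k` of the component at `g` is zero for `g ∉ A_k`, by the description of `D_g`. For
`g ∈ A_k` there is an `i` with `g A_i = A_k`, and the coordinate is the coefficient of the image at
`(k, i)` and `g_k⁻¹ g g_i`. -/
theorem crossedProductHom_injective :
    Function.Injective ((d.partialRep K).crossedProductHom K) := by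
  classical
  rw [injective_iff_map_eq_zero]
  intro x hx
  refine DirectSum.ext_component (M := fun g => ((d.partialRep K).toAction K).D g) K fun g => ?_
  refine Eq.trans ?_ (_root_.map_zero _).symm
  set a := DirectSum.component K G (fun g => ((d.partialRep K).toAction K).D g) g x
  refine Subtype.ext ((d.diagEquiv K).symm.injective ?_)
  rw [Submodule.coe_zero, _root_.map_zero]
  ext k
  have hmem : (a : (d.partialRep K).epsAlg K) ∈ (d.partialRep K).dom K g := a.2
  rw [← (d.diagEquiv K).apply_symm_apply (a : (d.partialRep K).epsAlg K),
    diagEquiv_mem_dom] at hmem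
  by_cases hk : g ∈ d.A k
  · obtain ⟨i, hi⟩ := d.mem_A_iff.1 hk
    refine (d.crossedProductHom_apply K x k i ⟨_, Mor.mem (d := d) ⟨i, k, g, hi⟩⟩ g
      (by group)).symm.trans ?_
    rw [hx]
    rfl
  · exact hmem k hk

/-- The matrices `e_{k,i}(t)` span `M_n(KH)`, and each is the image of `e_k δ_g` for `g = g_k t
g_i⁻¹`. -/
theorem crossedProductHom_surjective :
    Function.Surjective ((d.partialRep K).crossedProductHom K) := by
  classical
  rw [← AlgHom.range_eq_top, ← top_le_iff]
  set S := ((d.partialRep K).crossedProductHom K).range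
  have hmem : ∀ (k i : Fin n) (t : H), Matrix.single k i (MonoidAlgebra.single t (1 : K)) ∈ S := by
    intro k i t
    have hst : (t : G) • d.A 0 = d.A 0 := by
      exact MulAction.mem_stabilizer_iff.1 (d.stabilizer_eq.ge t.2)
    set g := d.rep k * t * (d.rep i)⁻¹ with hg
    have hgi : g • d.A i = d.A k := by
      rw [hg, mul_smul, mul_smul, ← d.rep_smul i, inv_smul_smul, hst, d.rep_smul]
    have hdom : d.diagEquiv K (Pi.single k 1) ∈ ((d.partialRep K).toAction K).D g := by
      refine (d.diagEquiv_mem_dom K).2 fun l hl => ?_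
      refine Pi.single_eq_of_ne ?_ _
      rintro rfl
      exact hl (d.mem_A_iff.2 ⟨i, hgi⟩)
    refine ⟨delta _ _ g ⟨_, hdom⟩, ?_⟩
    change (d.partialRep K).crossedProductHom K (delta _ _ g _) = _
    -- In the form `π(g) e_i` the image is column `i` of `π(g)`, whose only non-zero entry is in row
    -- `k`.
    rw [PartialRep.crossedProductHom_delta, diagEquiv_coe,
      ← d.partialRep_mul_diag_single K g hgi]
    ext1 l m
    rw [mul_diag_apply, partialRep_apply]
    by_cases hm : m = i
    · subst hm
      by_cases hl : l = k
      · subst hl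
        rw [d.tau_lam_eq_single K hgi t (by rw [hg]; group)]
        simp
      · rw [d.tau_lam_eq_zero K (by rw [hgi]; exact fun h => hl (d.injective h).symm)]
        simp [Ne.symm hl]
    · simp [hm, Ne.symm hm]
  intro M _
  rw [Matrix.matrix_eq_sum_single M]
  refine S.sum_mem fun k _ => S.sum_mem fun i _ => ?_
  induction M k i using MonoidAlgebra.induction_linear with
  | zero => simp
  | add f g hf hg => rw [Matrix.single_add]; exact S.add_mem hf hg
  | single t c =>
    have : Matrix.single k i (MonoidAlgebra.single t c) =
        c • Matrix.single k i (MonoidAlgebra.single t (1 : K)) := by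
      rw [Matrix.smul_single, MonoidAlgebra.smul_single, smul_eq_mul, mul_one]
    rw [this]
    exact S.smul_mem (hmem k i t) c

/-- An elementary partial representation is equivalent to the one given by its partial action. -/
theorem equivalent_ofAction_toAction : PartialRep.Equivalent K (d.partialRep K)
    (PartialRep.ofAction ((d.partialRep K).toAction K) (d.partialRep K).hasUnities_toAction) :=
  (d.partialRep K).equivalent_ofAction
    ⟨d.crossedProductHom_injective K, d.crossedProductHom_surjective K⟩

end ElementaryDatum

/-! ### Partial actions on `K^n` as partial permutations of `n` points -/

section coordinates

open PartialAction

variable {K G : Type*} [Field K] [Group G] {n : ℕ} (α : PartialAction K G (Fin n → K))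

theorem single_mem_D {g : G} {x : Fin n → K} (hx : x ∈ α.D g) {i : Fin n} (hi : x i ≠ 0) :
    (Pi.single i 1 : Fin n → K) ∈ α.D g := by
  have h : (Pi.single i 1 : Fin n → K) = Pi.single i (x i)⁻¹ * x := by
    ext j
    by_cases hj : j = i
    · subst hj
      simp [hi]
    · simp [hj]
  rw [h]
  exact α.mul_mem_left _ _ hx

theorem mem_supportSet {g : G} {i : Fin n} :
    g ∈ supportSet α i ↔ (Pi.single i 1 : Fin n → K) ∈ α.D g := by
  refine ⟨fun h => single_mem_D α (α.unity_mem (hasUnities α) g) h, fun h h0 => ?_⟩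
  have := congrFun (α.unity_mul (hasUnities α) h) i
  simp [h0] at this

theorem mem_D_iff {g : G} {x : Fin n → K} :
    x ∈ α.D g ↔ ∀ i, g ∉ supportSet α i → x i = 0 := by
  refine ⟨fun hx i hi => ?_, fun h => ?_⟩
  · by_contra h0
    exact hi ((mem_supportSet α).2 (single_mem_D α hx h0))
  · rw [pi_eq_sum_univ' x]
    refine Submodule.sum_mem _ fun i _ => ?_
    by_cases hi : g ∈ supportSet α i
    · exact Submodule.smul_mem _ _ ((mem_supportSet α).1 hi)
    · rw [h i hi, zero_smul]
      exact Submodule.zero_mem _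

theorem one_mem_supportSet (i : Fin n) : (1 : G) ∈ supportSet α i := by
  rw [mem_supportSet, α.D_one]
  trivial

/-- The partial action on `K^n` moves the `j`-th point to the `i`-th point: `α_g (e_j) = e_i`. -/
def Moves (g : G) (j i : Fin n) : Prop :=
  (Pi.single j 1 : Fin n → K) ∈ α.D g⁻¹ ∧ α.act g (Pi.single j 1) = Pi.single i 1

variable {α}

theorem Moves.mem {g : G} {j i : Fin n} (h : Moves α g j i) : g ∈ supportSet α i := by
  rw [mem_supportSet, ← h.2]
  exact α.act_mem h.1

theorem Moves.symm {g : G} {j i : Fin n} (h : Moves α g j i) : Moves α g⁻¹ i j := by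
  refine ⟨?_, ?_⟩
  · rw [inv_inv, ← h.2]
    exact α.act_mem h.1
  · rw [← h.2, α.act_inv_act h.1]

theorem Moves.mul {g h : G} {k j i : Fin n} (hg : Moves α g j i) (hh : Moves α h k j) :
    Moves α (g * h) k i := by
  have := hg.1
  rw [← hh.2] at this
  exact ⟨α.mem_of_act_mem g h hh.1 this, by rw [← α.act_act g h hh.1 this, hh.2, hg.2]⟩

-- Isomorphisms of ideals preserve primitive idempotents. Concretely, `f = α_g⁻¹(e_i)` has a
-- coordinate `f_j ≠ 0`, and `u = α_g(e_j)` is a non-zero idempotent with `u e_i = f_j u`; hence `u`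
-- lives on coordinate `i` and equals `e_i`.
variable (α) in
theorem exists_moves {g : G} {i : Fin n} (h : g ∈ supportSet α i) : ∃ j, Moves α g j i := by
  rw [mem_supportSet] at h
  have hf := α.act_inv_mem h
  have hgf := α.act_act_inv h
  set e : Fin n → K := Pi.single i 1 with he
  set f := α.act g⁻¹ e
  have hf0 : f ≠ 0 := by
    intro h0
    -- Homogeneity with the scalar 0 yields `α_g 0 = 0`.
    have h1 := α.map_smul g 0 hf
    rw [zero_smul, zero_smul, ← h0, hgf] at h1
    have := congrFun h1 i
    simp [he, h0] at this
  obtain ⟨j, hj⟩ := Function.ne_iff.1 hf0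
  have hjm := single_mem_D α hf hj
  refine ⟨j, hjm, ?_⟩
  set ej : Fin n → K := Pi.single j 1 with hej
  set u := α.act g ej
  -- This is `α_g` applied to `e_j f = f_j e_j`.
  have h1 : u * e = f j • u := by
    rw [← α.map_smul g _ hjm, ← hgf, ← α.map_mul g hjm hf]
    congr 1
    ext k
    by_cases hk : k = j
    · subst hk; simp [hej]
    · simp [hej, hk]
  have huu : u * u = u := by
    rw [← α.map_mul g hjm hjm]
    congr 1
    ext k
    by_cases hk : k = j
    · subst hk; simp [hej]
    · simp [hej, hk]
  have hu0 : u ≠ 0 := by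
    intro h0
    have h2 : α.act g⁻¹ u = ej := α.act_inv_act hjm
    have h3 := α.map_smul g⁻¹ 0 (α.mem_inv_inv (α.act_mem hjm))
    rw [zero_smul, zero_smul] at h3
    rw [h0, h3] at h2
    have := congrFun h2 j
    simp [hej] at this
  have huk : ∀ k, k ≠ i → u k = 0 := by
    intro k hk
    have := congrFun h1 k
    simpa [he, hk, show f j ≠ 0 from hj] using this
  have hui : u i ≠ 0 := by
    intro h0
    refine hu0 (funext fun k => ?_)
    by_cases hk : k = i
    · rw [hk, h0, Pi.zero_apply]
    · exact huk k hk
  ext k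
  by_cases hk : k = i
  · subst hk
    have := congrFun huu k
    rw [Pi.mul_apply] at this
    rw [Pi.single_eq_same]
    exact mul_left_cancel₀ hui (this.trans (mul_one _).symm)
  · rw [huk k hk, Pi.single_eq_of_ne hk]

/-- Members of `A_j(α)` label the moves that end at `j`. Composing these with the move `g` from `j`
to `i`, or those ending at `i` with its inverse, gives the two inclusions. -/
theorem Moves.smul_supportSet {g : G} {j i : Fin n} (h : Moves α g j i) :
    g • supportSet α j = supportSet α i := by
  ext k
  rw [Set.mem_smul_set_iff_inv_smul_mem, smul_eq_mul]
  constructor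
  · intro hk
    obtain ⟨l, hl⟩ := exists_moves α hk
    simpa using (h.mul hl).mem
  · intro hk
    obtain ⟨l, hl⟩ := exists_moves α hk
    exact (h.symm.mul hl).mem

end coordinates

/-! ### From the isotropy conditions to an elementary datum -/

section datum

variable {K G : Type*} [Field K] [Group G] {H : Subgroup G} {n : ℕ} [NeZero n]

/-- The element `a b⁻¹` carries `A` to `S` and back to `A`, so it stabilises `A`. Thus elements of
different cosets pull `A` back to different sets. -/
theorem coset_eq_of_smul_eq {A S : Set G} (hA : MulAction.stabilizer G A = H) {a b : G}
    (ha : a • S = A) (hb : b • S = A) : (H : Set G) * {a} = (H : Set G) * {b} := by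
  have hmem : a * b⁻¹ ∈ H := by
    rw [← hA, MulAction.mem_stabilizer_iff, mul_smul, ← hb, inv_smul_smul, hb, ha]
  ext x
  simp only [Set.mul_singleton, Set.image_mul_right, Set.mem_preimage, SetLike.mem_coe]
  have : x * b⁻¹ = x * a⁻¹ * (a * b⁻¹) := by group
  rw [this, H.mul_mem_cancel_right hmem]

/-- A partial action on `K^n` with `St(A_1) = H` and `(A_1 : H) = n` is transitive on the points,
and the sets `A_i` are distinct. -/
theorem HasIsotropy.exists_moves_zero {α : PartialAction K G (Fin n → K)} (hα : HasIsotropy H α) :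
    (∃ a : Fin n → G, ∀ i, Moves α (a i) i 0) ∧ Function.Injective (supportSet α) := by
  obtain ⟨hst, hidx⟩ := hα
  set C : Set (Set G) := (fun a : G => (H : Set G) * {a}) '' supportSet α 0 with hC
  have hfin : C.Finite := Set.finite_of_encard_eq_coe hidx
  have hcard : Nat.card C = n := by
    rw [Nat.card_coe_set_eq, Set.ncard, show C.encard = n from hidx]
    rfl
  -- Each coset receives a representative `a` and a point that `a` moves to the first one.
  have hrep : ∀ c : C, ∃ p : G × Fin n, (H : Set G) * {p.1} = c ∧ Moves α p.1 p.2 0 := by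
    rintro ⟨_, a, ha, rfl⟩
    obtain ⟨i, hi⟩ := exists_moves α ha
    exact ⟨(a, i), rfl, hi⟩
  choose p hpc hpm using hrep
  have hinj : Function.Injective fun c => (p c).2 := by
    intro c c' h
    refine Subtype.ext ?_
    rw [← hpc c, ← hpc c']
    have h' := (hpm c').smul_supportSet
    rw [← show (p c).2 = (p c').2 from h] at h'
    exact coset_eq_of_smul_eq hst (hpm c).smul_supportSet h'
  have : Finite C := hfin
  -- An injection from `n` cosets to `n` points is onto, so every point is moved to the first one by
  -- some element.
  have hbij := hinj.bijective_of_nat_card_le (by rw [hcard, Nat.card_fin])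
  refine ⟨?_, fun i j hij => ?_⟩
  · choose c hc using hbij.surjective
    refine ⟨fun i => (p (c i)).1, fun i => ?_⟩
    have := hpm (c i)
    rwa [show (p (c i)).2 = i from hc i] at this
  · obtain ⟨c, rfl⟩ := hbij.surjective i
    obtain ⟨c', rfl⟩ := hbij.surjective j
    have h' := (hpm c').smul_supportSet
    simp only at hij
    rw [← hij] at h'
    -- Equality of the sets attached to the two points already forces the cosets, and hence the
    -- points, to agree.
    have : c = c' := Subtype.ext <| by
      rw [← hpc c, ← hpc c']
      exact coset_eq_of_smul_eq hst (hpm c).smul_supportSet h'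
    rw [this]

/-- With `a_i` moving `i` to the first point, `g_i = a_i⁻¹` satisfies `g_i A_1 = A_i`. The
translates `g A_1` with `g⁻¹ ∈ A_1` are all of this kind, since `g⁻¹` moves some point to the first
one. -/
theorem HasIsotropy.exists_datum {α : PartialAction K G (Fin n → K)} (hα : HasIsotropy H α) :
    ∃ d : ElementaryDatum H n, d.A = supportSet α := by
  obtain ⟨⟨a, ha⟩, hinj⟩ := hα.exists_moves_zero
  refine ⟨{ A := supportSet α
            one_mem := one_mem_supportSet α 0
            stabilizer_eq := hα.1
            index_eq := hα.2
            injective := hinj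
            range_eq := ?_
            rep := fun i => (a i)⁻¹
            rep_smul := fun i => (ha i).symm.smul_supportSet }, rfl⟩
  ext S
  constructor
  · rintro ⟨i, rfl⟩
    exact ⟨(a i)⁻¹, by rw [inv_inv]; exact (ha i).mem, (ha i).symm.smul_supportSet.symm⟩
  · rintro ⟨g, hg, rfl⟩
    obtain ⟨j, hj⟩ := exists_moves α hg
    refine ⟨j, ?_⟩
    rw [← hj.symm.smul_supportSet, inv_inv]

end datum

/-! ### A partial action is determined by its sets `A_i(α)` -/

namespace ElementaryDatum

open PartialAction

variable {G : Type*} [Group G] {H : Subgroup G} {n : ℕ} [NeZero n] (d : ElementaryDatum H n)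
  (K : Type*) [Field K]

/-- The domains are coordinate ideals read off from the `A_i`. If `α_g(e_i) = e_j` then `g A_i =
A_j`, so `α^π` also sends `e_i` to `e_j`. The choice of the `g_i` plays no role. -/
theorem isEquivalence_diagEquiv {α : PartialAction K G (Fin n → K)} (h : d.A = supportSet α) :
    IsEquivalence (d.diagEquiv K) α ((d.partialRep K).toAction K) := by
  have hD : ∀ g x, d.diagEquiv K x ∈ (d.partialRep K).dom K g ↔ x ∈ α.D g := fun g x => by
    rw [diagEquiv_mem_dom, mem_D_iff, h]
  refine ⟨fun g => ?_, fun g x hx => ?_⟩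
  · ext y
    obtain ⟨x, rfl⟩ := (d.diagEquiv K).surjective y
    rw [(d.diagEquiv K).injective.mem_set_image]
    exact (hD g x).symm
  · have key : ∀ i, x i ≠ 0 → ((d.partialRep K).toAction K).act g (d.diagEquiv K (Pi.single i 1)) =
        d.diagEquiv K (α.act g (Pi.single i 1)) := by
      intro i hi
      have hm := single_mem_D α hx hi
      obtain ⟨j, hj⟩ := exists_moves α ((mem_supportSet α).2 hm)
      have hj' := hj.symm
      rw [inv_inv] at hj'
      rw [hj'.2]
      refine d.conj_diagEquiv_single K g ?_
      rw [h]
      exact hj'.smul_supportSet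
    -- The partial maps are additive only on their domains, so membership of the partial sums is
    -- carried through the induction.
    have hsum : ∀ s : Finset (Fin n),
        (∑ i ∈ s, x i • (Pi.single i 1 : Fin n → K)) ∈ α.D g⁻¹ ∧
        ((d.partialRep K).toAction K).act g
          (d.diagEquiv K (∑ i ∈ s, x i • (Pi.single i 1 : Fin n → K))) =
          d.diagEquiv K (α.act g (∑ i ∈ s, x i • (Pi.single i 1 : Fin n → K))) := by
      have hzero : ((d.partialRep K).toAction K).act g (d.diagEquiv K 0) =
          d.diagEquiv K (α.act g 0) := by
        have h1 := α.map_smul g 0 (Submodule.zero_mem (α.D g⁻¹))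
        have h2 := ((d.partialRep K).toAction K).map_smul g 0
          (Submodule.zero_mem (((d.partialRep K).toAction K).D g⁻¹))
        rw [zero_smul, zero_smul] at h1 h2
        rw [h1, _root_.map_zero, h2]
      have hterm : ∀ i, x i • (Pi.single i 1 : Fin n → K) ∈ α.D g⁻¹ := by
        intro i
        by_cases hi : x i = 0
        · rw [hi, zero_smul]
          exact Submodule.zero_mem _
        · exact Submodule.smul_mem _ _ (single_mem_D α hx hi)
      intro s
      induction s using Finset.induction_on with
      | empty => simpa using hzero
      | insert i s hi ih =>
        rw [Finset.sum_insert hi]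
        refine ⟨Submodule.add_mem _ (hterm i) ih.1, ?_⟩
        rw [_root_.map_add, ((d.partialRep K).toAction K).map_add g ((hD _ _).2 (hterm i))
          ((hD _ _).2 ih.1), α.map_add g (hterm i) ih.1, _root_.map_add, ih.2]
        congr 1
        by_cases hxi : x i = 0
        · rw [hxi, zero_smul]
          exact hzero
        · have hm := single_mem_D α hx hxi
          rw [_root_.map_smul, ((d.partialRep K).toAction K).map_smul g _ ((hD _ _).2 hm),
            α.map_smul g _ hm, _root_.map_smul, key i hxi]
    have := (hsum Finset.univ).2
    rwa [← pi_eq_sum_univ' x] at this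

end ElementaryDatum

/-! ### Transport of `α^π` to `K^n` -/

/-- Transport of a partial action along an algebra isomorphism. -/
def PartialAction.comap {K G A A' : Type*} [Field K] [Group G] [Ring A] [Algebra K A] [Ring A']
    [Algebra K A'] (φ : A ≃ₐ[K] A') (α : PartialAction K G A') : PartialAction K G A where
  D g := (α.D g).comap φ.toLinearMap
  mul_mem_left g a x hx := by
    change φ (a * x) ∈ α.D g
    rw [_root_.map_mul]
    exact α.mul_mem_left g _ hx
  mul_mem_right g a x hx := by
    change φ (x * a) ∈ α.D g
    rw [_root_.map_mul]
    exact α.mul_mem_right g _ hx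
  act g x := φ.symm (α.act g (φ x))
  bijOn g := by
    refine ⟨fun x hx => ?_, fun x hx y hy hxy => ?_, fun x hx => ?_⟩
    · change φ (φ.symm _) ∈ α.D g
      rw [AlgEquiv.apply_symm_apply]
      exact α.act_mem hx
    · exact φ.injective ((α.bijOn g).injOn hx hy (φ.symm.injective hxy))
    · obtain ⟨y, hy, hxy⟩ := (α.bijOn g).surjOn hx
      refine ⟨φ.symm y, ?_, ?_⟩
      · change φ (φ.symm y) ∈ α.D g⁻¹
        rwa [AlgEquiv.apply_symm_apply]
      · change φ.symm (α.act g (φ (φ.symm y))) = x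
        rw [AlgEquiv.apply_symm_apply, hxy]
        exact φ.symm_apply_apply x
  map_add g x y hx hy := by
    rw [_root_.map_add, α.map_add g (x := φ x) (y := φ y) hx hy, _root_.map_add]
  map_smul g c x hx := by
    rw [_root_.map_smul, α.map_smul g c (x := φ x) hx, _root_.map_smul]
  map_mul g x y hx hy := by
    rw [_root_.map_mul, α.map_mul g (x := φ x) (y := φ y) hx hy, _root_.map_mul]
  D_one := by rw [α.D_one, Submodule.comap_top]
  act_one x := by rw [α.act_one, AlgEquiv.symm_apply_apply]
  mem_of_act_mem g h x hx hx' := by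
    refine α.mem_of_act_mem g h hx ?_
    change φ (φ.symm _) ∈ α.D g⁻¹ at hx'
    rwa [AlgEquiv.apply_symm_apply] at hx'
  act_act g h x hx hx' := by
    change φ (φ.symm _) ∈ α.D g⁻¹ at hx'
    rw [AlgEquiv.apply_symm_apply] at hx' ⊢
    rw [α.act_act g h (x := φ x) hx hx']

theorem PartialAction.isEquivalence_comap {K G A A' : Type*} [Field K] [Group G] [Ring A]
    [Algebra K A] [Ring A'] [Algebra K A'] (φ : A ≃ₐ[K] A') (α : PartialAction K G A') :
    IsEquivalence φ (α.comap φ) α := by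
  refine ⟨fun g => ?_, fun g x _ => (φ.apply_symm_apply _).symm⟩
  exact Set.image_preimage_eq _ φ.surjective

namespace ElementaryDatum

variable {G : Type*} [Group G] {H : Subgroup G} {n : ℕ} [NeZero n] (d : ElementaryDatum H n)
  (K : Type*) [Field K]

/-- The partial action on `K^n` that corresponds to the partial action `α^π` of an elementary
partial representation. -/
def action : PartialAction K G (Fin n → K) := ((d.partialRep K).toAction K).comap (d.diagEquiv K)

theorem isEquivalence_action :
    PartialAction.IsEquivalence (d.diagEquiv K) (d.action K) ((d.partialRep K).toAction K) :=
  PartialAction.isEquivalence_comap _ _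

/-- This passes the stabiliser and index conditions of the datum on to the partial action. -/
theorem supportSet_action : supportSet (d.action K) = d.A := by
  ext i g
  rw [mem_supportSet]
  refine (d.diagEquiv_mem_dom K).trans ⟨fun h => ?_, fun h j hj => ?_⟩
  · by_contra hi
    simpa using h i hi
  · refine Pi.single_eq_of_ne ?_ _
    rintro rfl
    exact hj h

theorem hasIsotropy_action : HasIsotropy H (d.action K) := by
  rw [HasIsotropy, supportSet_action]
  exact ⟨d.stabilizer_eq, d.index_eq⟩

end ElementaryDatum

/-! ### The bijection of equivalence classes -/

section classes

variable {K G : Type*} [Field K] [Group G] {H : Subgroup G} {n : ℕ} [NeZero n]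

theorem IsElementary.equivalent_ofAction
    {π : PartialRep G (Matrix (Fin n) (Fin n) (MonoidAlgebra K H))} (hπ : IsElementary K π) :
    PartialRep.Equivalent K π (PartialRep.ofAction (π.toAction K) π.hasUnities_toAction) := by
  obtain ⟨d, rfl⟩ := hπ
  exact d.equivalent_ofAction_toAction K

theorem IsElementary.exists_action
    {π : PartialRep G (Matrix (Fin n) (Fin n) (MonoidAlgebra K H))} (hπ : IsElementary K π) :
    ∃ (α : PartialAction K G (Fin n → K)) (φ : (Fin n → K) ≃ₐ[K] π.epsAlg K),
      HasIsotropy H α ∧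
      (∀ x : Fin n → K, (φ x : Matrix (Fin n) (Fin n) (MonoidAlgebra K H)) =
        Matrix.diagonal fun i => algebraMap K (MonoidAlgebra K H) (x i)) ∧
      PartialAction.IsEquivalence φ α (π.toAction K) := by
  obtain ⟨d, rfl⟩ := hπ
  exact ⟨d.action K, d.diagEquiv K, d.hasIsotropy_action K, fun _ => rfl,
    d.isEquivalence_action K⟩

theorem HasIsotropy.exists_elementary {α : PartialAction K G (Fin n → K)} (hα : HasIsotropy H α) :
    ∃ π : PartialRep G (Matrix (Fin n) (Fin n) (MonoidAlgebra K H)), IsElementary K π ∧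
      PartialAction.Equivalent (π.toAction K) α := by
  obtain ⟨d, hd⟩ := hα.exists_datum
  exact ⟨d.partialRep K, ⟨d, rfl⟩,
    PartialAction.Equivalent.symm ⟨d.diagEquiv K, d.isEquivalence_diagEquiv K hd⟩⟩

/-- `α^π` is equivalent to `α` if and only if `π_α` is equivalent to `π`. -/
theorem toAction_equivalent_iff {π : PartialRep G (Matrix (Fin n) (Fin n) (MonoidAlgebra K H))}
    (hπ : IsElementary K π) {α : PartialAction K G (Fin n → K)} (hα : HasIsotropy H α) :
    PartialAction.Equivalent (π.toAction K) α ↔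
      PartialRep.Equivalent K (PartialRep.ofAction α (hasUnities α)) π := by
  have key : ∀ {π' : PartialRep G (Matrix (Fin n) (Fin n) (MonoidAlgebra K H))},
      IsElementary K π' → PartialAction.Equivalent (π'.toAction K) α →
      PartialRep.Equivalent K (PartialRep.ofAction α (hasUnities α)) π' := fun hπ' h =>
    (hπ'.equivalent_ofAction.trans (h.ofAction _ _)).symm
  refine ⟨key hπ, fun h => ?_⟩
  -- The partial action of `π_α` is never computed: an elementary `π'` with `α^{π'}` equivalent to
  -- `α` is equivalent to `π_α`, hence to `π`, and functoriality carries this back to the partial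
  -- actions.
  obtain ⟨π', hπ', h'⟩ := hα.exists_elementary
  exact ((h.symm.trans (key hπ' h')).toAction).trans h'

variable (K H n) in
/-- The map of equivalence classes induced by `π ↦ α^π`. -/
def classMap : Quotient (elementarySetoid K H n) → Quotient (actionSetoid K H n) :=
  Quotient.lift (fun π => Quotient.mk _
      ⟨π.2.exists_action.choose, π.2.exists_action.choose_spec.choose_spec.1⟩) fun π π' h => by
    obtain ⟨_, h1⟩ := π.2.exists_action.choose_spec
    obtain ⟨_, h2⟩ := π'.2.exists_action.choose_spec
    exact Quotient.sound ((PartialAction.Equivalent.trans ⟨_, h1.2.2⟩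
      (PartialRep.Equivalent.toAction h)).trans (PartialAction.Equivalent.symm ⟨_, h2.2.2⟩))

/-- The model of `α^π` on `K^n` is an arbitrary choice, but it is equivalent to `α^π`, so the choice
drops out. -/
theorem classMap_mk_eq_iff
    (π : {π : PartialRep G (Matrix (Fin n) (Fin n) (MonoidAlgebra K H)) // IsElementary K π})
    (α : {α : PartialAction K G (Fin n → K) // HasIsotropy H α}) :
    classMap K H n (Quotient.mk _ π) = Quotient.mk _ α ↔
      PartialAction.Equivalent (π.1.toAction K) α.1 := by
  obtain ⟨φ, h1⟩ := π.2.exists_action.choose_spec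
  have h2 : PartialAction.Equivalent _ (π.1.toAction K) := ⟨φ, h1.2.2⟩
  exact Quotient.eq.trans ⟨fun h => h2.symm.trans h, fun h => h2.trans h⟩

/-- If `α^π` and `α^{π'}` are both equivalent to `α`, then `π` and `π'` are both equivalent to
`π_α`. Surjectivity is the construction of an elementary datum from `α`. -/
theorem classMap_bijective : Function.Bijective (classMap K H n) := by
  constructor
  · intro a b hab
    induction a using Quotient.inductionOn with | _ π
    induction b using Quotient.inductionOn with | _ π'
    obtain ⟨α, hα⟩ := Quotient.exists_rep (classMap K H n (Quotient.mk _ π))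
    have h1 := (toAction_equivalent_iff π.2 α.2).1 ((classMap_mk_eq_iff π α).1 hα.symm)
    have h2 := (toAction_equivalent_iff π'.2 α.2).1
      ((classMap_mk_eq_iff π' α).1 (hab.symm.trans hα.symm))
    exact Quotient.sound (h1.symm.trans h2)
  · intro b
    induction b using Quotient.inductionOn with | _ α
    obtain ⟨π, hπ, h⟩ := α.2.exists_elementary
    exact ⟨Quotient.mk _ ⟨π, hπ⟩, (classMap_mk_eq_iff ⟨π, hπ⟩ α).2 h⟩

end classes

end PartialActions

end

open PartialActions in
/-- One-to-one correspondence between elementary partial representations `G → M_n(KH)` and partial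
actions `α` of `G` on `K^n` with `St(A_1(α)) = H` and `(A_1(α) : H) = n`, up to equivalence. -/
theorem theorem6p9 {K G : Type*} [Field K] [Group G] (H : Subgroup G) (n : ℕ) [NeZero n] :
    -- `α^π` is a partial action on `diag(K, ..., K) = K^n` which satisfies the two conditions
    (∀ π : PartialRep G (Matrix (Fin n) (Fin n) (MonoidAlgebra K H)), IsElementary K π →
      ∃ (α : PartialAction K G (Fin n → K)) (φ : (Fin n → K) ≃ₐ[K] π.epsAlg K),
        HasIsotropy H α ∧
        (∀ x : Fin n → K, (φ x : Matrix (Fin n) (Fin n) (MonoidAlgebra K H)) =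
          Matrix.diagonal fun i => algebraMap K (MonoidAlgebra K H) (x i)) ∧
        PartialAction.IsEquivalence φ α (π.toAction K)) ∧
    -- the maps `π ↦ α^π` and `α ↦ π_α` induce mutually inverse bijections of equivalence classes
    (∃ Φ : Quotient (elementarySetoid K H n) ≃ Quotient (actionSetoid K H n),
      (∀ π α, Φ (Quotient.mk _ π) = Quotient.mk _ α ↔
        PartialAction.Equivalent (π.1.toAction K) α.1) ∧
      (∀ α π, Φ.symm (Quotient.mk _ α) = Quotient.mk _ π ↔
        PartialRep.Equivalent K (PartialRep.ofAction α.1 (hasUnities α.1)) π.1)) := by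
  refine ⟨fun π hπ => hπ.exists_action, Equiv.ofBijective _ classMap_bijective,
    classMap_mk_eq_iff, fun α π => ?_⟩
  rw [Equiv.symm_apply_eq, eq_comm]
  exact (classMap_mk_eq_iff π α).trans (toAction_equivalent_iff π.2 α.2)
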